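/- **Theorem (asymptotic normality for linear functionals).** *Setting.* Let $W_i=(Y_i,X_i,Z_i)$, $i\ge 1$, be i.i.d. with law $F_0$; $E$ denotes expectation under $F_0$, and $\|\cdot\|$ is the $L_2(F_0)$ norm for functions of the data. Let $\Gamma$ be a linear space of measurable functions $\gamma$ with $E[\gamma(X)^2]<\infty$ (for instance all of them), and let $m(w,\gamma)$ be real-valued, linear in $\gamma\in\Gamma$ and measurable in $w$. Let $\gamma_0\in\Gamma$ satisfy $E[(Y-\gamma_0(X))^2]<\infty$ and $E[Y-\gamma_0(X)\mid Z]=0$, put $\theta_0=E[m(W,\gamma_0)]$, and let $\alpha_0$ be a measurable function such that, for all $\gamma\in\Gamma$, $m(W,\gamma)$ is integrable and $E[m(W,\gamma)]=E[\alpha_0(Z)\gamma(X)]$. Write $T\gamma=E[\gamma(X)\mid Z]$. For each $n$ let $b=(b_1,\dots,b_p)$ be measurable functions of $z$ and $d=(d_1,\dots,d_q)$ elements of $\Gamma$, where $p=p_n\le q=q_n$ and $q\ge2$; all of these may change with $n$. Let $M=E[m(W,d)]\in\mathbb R^q$ and $G=E[d(X)b(Z)']\in\mathbb R^{q\times p}$.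 For vectors, $|\cdot|_1$ and $\|\cdot\|_\infty$ are the $\ell_1$ and maximum norms; $\|A\|_{\ell_\infty}=\max_i\sum_j|A_{ij}|$; for $\delta\in\mathbb R^p$ and an index set $S$, $\delta_S$ is $\delta$ with the coordinates outside $S$ set to zero. *Estimator.* Let $L\ge2$ be fixed and, for each $n$, let $I_1,\dots,I_L$ be a non-random partition of $\{1,\dots,n\}$ with $n_\ell=|I_\ell|$ and $n_\ell/n\to1/L$. For each $\ell$, the following depend only on the observations outside $I_\ell$: an estimator $\hat\gamma_\ell\in\Gamma$ (with $\hat\gamma_\ell(x)$ and $m(w,\hat\gamma_\ell)$ jointly measurable in those observations and in $x$, respectively $w$), a symmetric positive semidefinite $q\times q$ matrix $\hat\Omega_\ell$, and $$\hat M_\ell=\frac1{n-n_\ell}\sum_{i\notin I_\ell}m(W_i,d),\qquad \hat G_\ell=\frac1{n-n_\ell}\sum_{i\notin I_\ell}d(X_i)b(Z_i)'.$$ With $\lambda_n>0$, let $\hat\rho_\ell$ be any measurable choice of a minimizer over $\rho\in\mathbb R^p$ of $$(\hat M_\ell-\hat G_\ell\rho)'\,\tfrac1q\hat\Omega_\ell\,(\hat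 M_\ell-\hat G_\ell\rho)+2\lambda_n|\rho|_1 ,$$ and $\hat\alpha_\ell(z)=b(z)'\hat\rho_\ell$. Define $$\hat\theta=\frac1n\sum_{\ell=1}^L\sum_{i\in I_\ell}\{m(W_i,\hat\gamma_\ell)+\hat\alpha_\ell(Z_i)[Y_i-\hat\gamma_\ell(X_i)]\},\qquad \hat V=\frac1n\sum_{\ell=1}^L\sum_{i\in I_\ell}\{m(W_i,\hat\gamma_\ell)-\hat\theta+\hat\alpha_\ell(Z_i)[Y_i-\hat\gamma_\ell(X_i)]\}^2 .$$ *Assumptions.* Constants do not depend on $n$; conditions on non-random objects hold for all sufficiently large $n$, and stochastic ones hold for each $\ell$. 1. There are non-random matrices $\Omega=\Omega_n$ with $\|\hat\Omega_\ell-\Omega\|_{\ell_\infty}=O_p(\sqrt{\log q/n})$ and $\|\Omega\|_{\ell_\infty}\le C$. Write $\Omega_q=\Omega/q$. 2. Almost surely $\max_{j\le p}|b_j(Z)|\le C_b$ and $\max_{j\le q}|d_j(X)|\le C_d$. 3. $\|\hat M_\ell-M\|_\infty=O_p(\varepsilon_n^M)$ with $\varepsilon_n^M=o(1)$. Let $\varepsilon_n=\max\{\sqrt{\log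 q/n},\varepsilon_n^M\}$. 4. There are $\bar\rho=\bar\rho_n\in\mathbb R^p$ with at most $\bar s=\bar s_n$ non-zero elements and $C>1$, $\bar A<\infty$ with $\|\alpha_0-b'\bar\rho\|^2\le C\bar s\,\varepsilon_n^2$ and $|\bar\rho|_1\le\bar A$. 5. The eigenvalues of $G'\Omega_qG$ are at most $C$, and for some $c>0$ $$\frac{\delta'G'\Omega_qG\delta}{\|\delta_S\|^2}\ge c\quad\text{for all }S\subseteq\{1,\dots,p\},\ |S|\le\bar s,\ \text{and all }\delta\in\mathbb R^p\setminus\{0\}\text{ with }|\delta_{S^c}|_1\le3|\delta_S|_1 .$$ 6. For some $C$, $P(\max_{j\le q}|m(W,d_j)|\le C)\to1$. 7. $\alpha_0(Z)$ and $E[(Y-\gamma_0(X))^2\mid Z]$ are almost surely bounded, and $E[m(W,\gamma_0)^2]<\infty$. 8. $\int[m(w,\hat\gamma_\ell)-m(w,\gamma_0)]^2F_0(dw)\to_p0$ and $\|\hat\gamma_\ell-\gamma_0\|\to_p0$. 9. $\|T(\hat\gamma_\ell-\gamma_0)\|=O_p(\kappa_n^\gamma)$ with $\kappa_n^\gamma=o(1)$.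 10. $\sqrt n\,\kappa_n^\alpha\kappa_n^\gamma\to0$, where $\kappa_n^\alpha=\bar s\lambda_n$. *Conclusion.* If in addition $\varepsilon_n=o(\lambda_n)$ and $\bar s\lambda_n=o(1)$, then for $\psi_0(w)=m(w,\gamma_0)-\theta_0+\alpha_0(z)[y-\gamma_0(x)]$ we have $V:=E[\psi_0(W)^2]<\infty$, $$\sqrt n(\hat\theta-\theta_0)\to_d N(0,V)\qquad\text{and}\qquad\hat V\to_pV .$$ -/

import Mathlib

open MeasureTheory ProbabilityTheory Filter Topology Asymptotics
open scoped Matrix ENNReal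

noncomputable section

namespace PGMM

/-- An observation `w = (y, x, z)`: outcome, endogenous regressors, instruments. -/
abbrev Obs (𝒳 𝒵 : Type*) := ℝ × 𝒳 × 𝒵

/-- The outcome component of an observation. -/
abbrev Obs.y {𝒳 𝒵 : Type*} (w : Obs 𝒳 𝒵) : ℝ := w.1

/-- The regressor component of an observation. -/
abbrev Obs.x {𝒳 𝒵 : Type*} (w : Obs 𝒳 𝒵) : 𝒳 := w.2.1

/-- The instrument component of an observation. -/
abbrev Obs.z {𝒳 𝒵 : Type*} (w : Obs 𝒳 𝒵) : 𝒵 := w.2.2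

/-- `X_n = O_p(a_n)` for nonnegative, possibly infinite, random quantities `X_n`:
for every `δ > 0` there is `K > 0` with `P (X_n > K a_n) ≤ δ` for all large `n`. -/
def IsBigOInProb {Ω : Type*} [MeasurableSpace Ω] (P : Measure Ω)
    (X : ℕ → Ω → ℝ≥0∞) (a : ℕ → ℝ) : Prop :=
  ∀ δ : ℝ, 0 < δ → ∃ K : ℝ, 0 < K ∧
    ∀ᶠ n in atTop, P {ω | ENNReal.ofReal (K * a n) < X n ω} ≤ ENNReal.ofReal δ

/-- `X_n → 0` in probability for nonnegative, possibly infinite, random quantities `X_n`. -/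
def TendstoZeroInProb {Ω : Type*} [MeasurableSpace Ω] (P : Measure Ω)
    (X : ℕ → Ω → ℝ≥0∞) : Prop :=
  ∀ η : ℝ, 0 < η → Tendsto (fun n => P {ω | ENNReal.ofReal η ≤ X n ω}) atTop (𝓝 0)

/-- The `ℓ∞`-induced matrix norm, i.e. the largest absolute row sum. -/
def rowSumNorm {q : ℕ} (A : Matrix (Fin q) (Fin q) ℝ) : ℝ :=
  ⨆ i : Fin q, ∑ j : Fin q, |A i j|

section Model

variable {𝒳 𝒵 : Type*} [MeasurableSpace 𝒳] [MeasurableSpace 𝒵]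

/-- The sigma-algebra on observations generated by the instruments. -/
@[reducible] def sigmaZ (𝒳 𝒵 : Type*) [MeasurableSpace 𝒵] : MeasurableSpace (Obs 𝒳 𝒵) :=
  MeasurableSpace.comap (fun w : Obs 𝒳 𝒵 => w.z) inferInstance

/-- The mean square norm `‖g(X)‖ = (E[g(X)²])^{1/2}`. -/
def normX (F₀ : Measure (Obs 𝒳 𝒵)) (g : 𝒳 → ℝ) : ℝ≥0∞ :=
  eLpNorm (fun w : Obs 𝒳 𝒵 => g w.x) 2 F₀

/-- The mean square norm `‖a(Z)‖ = (E[a(Z)²])^{1/2}`. -/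
def normZ (F₀ : Measure (Obs 𝒳 𝒵)) (a : 𝒵 → ℝ) : ℝ≥0∞ :=
  eLpNorm (fun w : Obs 𝒳 𝒵 => a w.z) 2 F₀

/-- The projected norm `‖T g‖ = (E[(E[g(X) | Z])²])^{1/2}`. -/
def projNorm (F₀ : Measure (Obs 𝒳 𝒵)) (g : 𝒳 → ℝ) : ℝ≥0∞ :=
  eLpNorm (F₀[fun w : Obs 𝒳 𝒵 => g w.x | sigmaZ 𝒳 𝒵]) 2 F₀

/-- `G = E[d(X) b(Z)']`. -/
def popG {p q : ℕ} (F₀ : Measure (Obs 𝒳 𝒵)) (d : Fin q → 𝒳 → ℝ) (b : Fin p → 𝒵 → ℝ) :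
    Matrix (Fin q) (Fin p) ℝ :=
  Matrix.of fun j k => ∫ w, d j w.x * b k w.z ∂F₀

/-- `M = E[m(W, d)]`. -/
def popM {Γ : Submodule ℝ (𝒳 → ℝ)} {q : ℕ} (F₀ : Measure (Obs 𝒳 𝒵))
    (m : Obs 𝒳 𝒵 → Γ →ₗ[ℝ] ℝ) (d : Fin q → Γ) : Fin q → ℝ :=
  fun j => ∫ w, m w (d j) ∂F₀

/-- Sample analogue of `G` over the observations `s i`, `i : ι`. -/
def sampleG {ι : Type*} [Fintype ι] {p q : ℕ} (d : Fin q → 𝒳 → ℝ) (b : Fin p → 𝒵 → ℝ)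
    (s : ι → Obs 𝒳 𝒵) : Matrix (Fin q) (Fin p) ℝ :=
  Matrix.of fun j k => (Fintype.card ι : ℝ)⁻¹ * ∑ i, d j (s i).x * b k (s i).z

/-- Sample analogue of `M` over the observations `s i`, `i : ι`. -/
def sampleM {Γ : Submodule ℝ (𝒳 → ℝ)} {ι : Type*} [Fintype ι] {q : ℕ}
    (m : Obs 𝒳 𝒵 → Γ →ₗ[ℝ] ℝ) (d : Fin q → Γ) (s : ι → Obs 𝒳 𝒵) : Fin q → ℝ :=
  fun j => (Fintype.card ι : ℝ)⁻¹ * ∑ i, m (s i) (d j)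

/-- The rescaled weight matrix `Ω_q = Ω / q`. -/
def scaledWeight {q : ℕ} (Om : Matrix (Fin q) (Fin q) ℝ) : Matrix (Fin q) (Fin q) ℝ :=
  (q : ℝ)⁻¹ • Om

/-- The penalized GMM objective `(M - Gρ)' Ω_q (M - Gρ) + 2 λ |ρ|₁`. -/
def pgmmObjective {p q : ℕ} (M : Fin q → ℝ) (G : Matrix (Fin q) (Fin p) ℝ)
    (Om : Matrix (Fin q) (Fin q) ℝ) (lam : ℝ) (ρ : Fin p → ℝ) : ℝ :=
  (M - G *ᵥ ρ) ⬝ᵥ (scaledWeight Om *ᵥ (M - G *ᵥ ρ)) + 2 * lam * ∑ k, |ρ k|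

/-- The matrix `G' Ω_q G`. -/
def gramG {p q : ℕ} (G : Matrix (Fin q) (Fin p) ℝ) (Om : Matrix (Fin q) (Fin q) ℝ) :
    Matrix (Fin p) (Fin p) ℝ :=
  Gᵀ * scaledWeight Om * G

/-- All eigenvalues of `A` are at most `C`. -/
def EigenvaluesLE {p : ℕ} (A : Matrix (Fin p) (Fin p) ℝ) (C : ℝ) : Prop :=
  ∀ μ : ℝ, Module.End.HasEigenvalue (Matrix.toLin' A) μ → μ ≤ C

/-- The restricted eigenvalue bound `φ²(s) ≥ c`: `δ'Aδ / ‖δ_S‖² ≥ c` for all `δ ≠ 0` and all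
index sets `S` with `|S| ≤ s` and `|δ_{Sᶜ}|₁ ≤ 3 |δ_S|₁`. The denominator is positive there. -/
def RestrictedEigenvalueGE {p : ℕ} (A : Matrix (Fin p) (Fin p) ℝ) (s : ℕ) (c : ℝ) : Prop :=
  ∀ (S : Finset (Fin p)) (δ : Fin p → ℝ), S.card ≤ s → δ ≠ 0 →
    ∑ k ∈ Sᶜ, |δ k| ≤ 3 * ∑ k ∈ S, |δ k| →
      c ≤ (δ ⬝ᵥ (A *ᵥ δ)) / ∑ k ∈ S, δ k ^ 2

/-- The linear combination `b(z)'ρ`. -/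
def linComb {p : ℕ} (b : Fin p → 𝒵 → ℝ) (ρ : Fin p → ℝ) (z : 𝒵) : ℝ :=
  ∑ k, b k z * ρ k

/-- The orthogonal moment function `ψ(w, θ, γ, α) = m(w, γ) - θ + α(z) (y - γ(x))`. -/
def psi {Γ : Submodule ℝ (𝒳 → ℝ)} (m : Obs 𝒳 𝒵 → Γ →ₗ[ℝ] ℝ) (θ : ℝ) (γ : Γ) (α : 𝒵 → ℝ)
    (w : Obs 𝒳 𝒵) : ℝ :=
  m w γ - θ + α w.z * (w.y - (γ : 𝒳 → ℝ) w.x)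

/-- A training sample for fold `ℓ`: the observations whose index is not in fold `ℓ`. -/
abbrev Train (𝒳 𝒵 : Type*) {n L : ℕ} (fold : Fin n → Fin L) (ℓ : Fin L) :=
  {i : Fin n // fold i ≠ ℓ} → Obs 𝒳 𝒵

/-- The part of the sample that is not in fold `ℓ`. -/
def leaveOut {n L : ℕ} (fold : Fin n → Fin L) (ℓ : Fin L) (s : Fin n → Obs 𝒳 𝒵) :
    Train 𝒳 𝒵 fold ℓ :=
  fun i => s i

/-- The cross-fitted debiased estimator
`θ̂ = n⁻¹ ∑_ℓ ∑_{i ∈ I_ℓ} {m(W_i, γ̂_ℓ) + α̂_ℓ(Z_i) [Y_i - γ̂_ℓ(X_i)]}`, with `α̂_ℓ = b'ρ̂_ℓ`. -/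
def thetaHat {Γ : Submodule ℝ (𝒳 → ℝ)} {n L p : ℕ} (m : Obs 𝒳 𝒵 → Γ →ₗ[ℝ] ℝ)
    (b : Fin p → 𝒵 → ℝ) (fold : Fin n → Fin L)
    (γhat : (ℓ : Fin L) → Train 𝒳 𝒵 fold ℓ → Γ)
    (ρhat : (ℓ : Fin L) → Train 𝒳 𝒵 fold ℓ → Fin p → ℝ)
    (s : Fin n → Obs 𝒳 𝒵) : ℝ :=
  (n : ℝ)⁻¹ * ∑ ℓ : Fin L, ∑ i : Fin n with fold i = ℓ,
    psi m 0 (γhat ℓ (leaveOut fold ℓ s)) (linComb b (ρhat ℓ (leaveOut fold ℓ s))) (s i)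

/-- The variance estimator `V̂ = n⁻¹ ∑_ℓ ∑_{i ∈ I_ℓ} ψ(W_i, θ̂, γ̂_ℓ, α̂_ℓ)²`. -/
def varHat {Γ : Submodule ℝ (𝒳 → ℝ)} {n L p : ℕ} (m : Obs 𝒳 𝒵 → Γ →ₗ[ℝ] ℝ)
    (b : Fin p → 𝒵 → ℝ) (fold : Fin n → Fin L)
    (γhat : (ℓ : Fin L) → Train 𝒳 𝒵 fold ℓ → Γ)
    (ρhat : (ℓ : Fin L) → Train 𝒳 𝒵 fold ℓ → Fin p → ℝ)
    (s : Fin n → Obs 𝒳 𝒵) : ℝ :=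
  (n : ℝ)⁻¹ * ∑ ℓ : Fin L, ∑ i : Fin n with fold i = ℓ,
    psi m (thetaHat m b fold γhat ρhat s) (γhat ℓ (leaveOut fold ℓ s))
      (linComb b (ρhat ℓ (leaveOut fold ℓ s))) (s i) ^ 2

end Model

/-- The rate `√(log q / n)`. -/
def epsG (q : ℕ → ℕ) (n : ℕ) : ℝ := √(Real.log (q n) / n)

/-- The rate `ε_n = max {√(log q / n), ε_n^M}`. -/
def epsMax (q : ℕ → ℕ) (εM : ℕ → ℝ) (n : ℕ) : ℝ := max (epsG q n) (εM n)

end PGMM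

end

/-!
The cross-fitted estimator is shown to be asymptotically equivalent to the oracle average of the
influence function `ψ₀`; the central limit theorem, Slutsky's theorem and the law of large numbers
then give the conclusion.

For each fold, let `e` be the difference between the estimated and the true moment function, a
function of the observation that depends on the data only through the other folds
(`momentError`). By `sqrt_mul_thetaHat_sub`, the difference between `√n (θ̂ - θ₀)` and the oracle
average is made of the fold sums of `e` centred at their conditional means, and of those conditional
means. Given the other folds the former have variance at most the mean square of `e`, which tends
to zero in probability by the consistency of `γ̂` and `α̂` and the boundedness of the conditional
variance of the outcome error (`tendsto_whp_sqrt_mul_fold_sum`, `lintegral_psi_sub_sq_le`). The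
latter are not small by themselves: it is the orthogonality of the moment function that leaves only
`E[(α₀ - α̂)(Z) (γ̂ - γ₀)(X)]`, where `γ̂ - γ₀` may be replaced by its projection on `Z`. They are
bounded by the product of `‖α̂ - α₀‖` and `‖T (γ̂ - γ₀)‖` (`ofReal_abs_integral_psi_sub_le`), which
is `o_p(1 / √n)`.

The remaining ingredient is the rate `‖α̂ - α₀‖ = O_p(s̄ λ)`
(`exists_eventually_whp_normZ_sub_le`). It comes from an `ℓ₁` bound for the penalized GMM program,
`l1_bound_of_isMinOn`: since `b` is bounded, the `ℓ₁` error of the coefficients bounds the mean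
square error of `b'ρ̂`. The score at `ρ̄` has two parts. The sampling error of the moments is
`o(λ)` in maximum norm, by the assumed rate for `M̂` and by Hoeffding's inequality with a union
bound for `Ĝ`. The approximation error `M - Gρ̄` is only of order `√s̄ ε`, which can exceed `λ`; the Cauchy-Schwarz
inequality for the weight `Ω̂` turns it into a term of order `s̄ ε²` in the basic inequality. After
that the usual argument with the cone and the restricted eigenvalue bound applies.

Convergence in probability is handled through the filter `whp P` on `ℕ × Ω`, so that the algebra of
limits of real functions is available for random sequences.
-/

namespace PGMM

/-! ### Convergence in probability as convergence along a filter -/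

section whp

variable {Ω : Type*} [MeasurableSpace Ω]

/-- The filter on `ℕ × Ω` of properties that hold with probability tending to one: `A` belongs to
it when `P {ω | (n, ω) ∉ A} → 0`. The measure is used as an outer measure, so that no measurability
is asked of `A`. Convergence in probability is `Tendsto` along this filter. -/
def whp (P : Measure Ω) : Filter (ℕ × Ω) where
  sets := {A | Tendsto (fun n => P {ω | (n, ω) ∉ A}) atTop (𝓝 0)}
  univ_sets := by simp
  sets_of_superset {A B} hA hAB := by
    refine tendsto_of_tendsto_of_tendsto_of_le_of_le tendsto_const_nhds hA (fun _ => zero_le) ?_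
    exact fun n => measure_mono fun ω hω h => hω (hAB h)
  inter_sets {A B} hA hB := by
    have h := Tendsto.add hA hB
    rw [add_zero] at h
    refine tendsto_of_tendsto_of_tendsto_of_le_of_le tendsto_const_nhds h (fun _ => zero_le) ?_
    intro n
    refine (measure_mono ?_).trans (measure_union_le _ _)
    intro ω hω
    by_contra h'
    simp only [Set.mem_union, Set.mem_ofPred_eq, not_or, not_not] at h'
    exact hω ⟨h'.1, h'.2⟩

variable {P : Measure Ω}

lemma eventually_whp {p : ℕ × Ω → Prop} :
    (∀ᶠ x in whp P, p x) ↔ Tendsto (fun n => P {ω | ¬ p (n, ω)}) atTop (𝓝 0) := Iff.rfl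

lemma eventually_whp_of_ae {p : ℕ × Ω → Prop} (h : ∀ᶠ n in atTop, ∀ᵐ ω ∂P, p (n, ω)) :
    ∀ᶠ x in whp P, p x := by
  rw [eventually_whp]
  refine tendsto_const_nhds.congr' ?_
  filter_upwards [h] with n hn
  exact (ae_iff.1 hn).symm

lemma tendsto_fst_whp : Tendsto Prod.fst (whp P) atTop := by
  intro A hA
  exact eventually_whp_of_ae (p := fun x => x.1 ∈ A) (by filter_upwards [hA] with n hn; simp [hn])

lemma eventually_whp_of_eventually {p : ℕ → Prop} (h : ∀ᶠ n in atTop, p n) :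
    ∀ᶠ x in whp P, p x.1 := tendsto_fst_whp.eventually h

lemma eventually_whp_of_le {p : ℕ × Ω → Prop}
    (h : ∀ δ : ℝ, 0 < δ → ∀ᶠ n in atTop, P {ω | ¬ p (n, ω)} ≤ ENNReal.ofReal δ) :
    ∀ᶠ x in whp P, p x := by
  rw [eventually_whp, ENNReal.tendsto_nhds_zero]
  intro ε hε
  rcases eq_or_ne ε ∞ with rfl | hε'
  · simp
  · have := h ε.toReal (ENNReal.toReal_pos hε.ne' hε')
    rwa [ENNReal.ofReal_toReal hε'] at this

lemma tendstoInMeasure_iff_tendsto_whp {X : ℕ → Ω → ℝ} {c : ℝ} :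
    TendstoInMeasure P X atTop (fun _ => c) ↔
      Tendsto (fun x : ℕ × Ω => X x.1 x.2) (whp P) (𝓝 c) := by
  rw [tendstoInMeasure_iff_dist, Metric.tendsto_nhds]
  simp only [eventually_whp, not_lt]

lemma TendstoZeroInProb.eventually_whp {X : ℕ → Ω → ℝ≥0∞} (h : TendstoZeroInProb P X) {η : ℝ}
    (hη : 0 < η) : ∀ᶠ x in whp P, X x.1 x.2 < ENNReal.ofReal η := by
  rw [PGMM.eventually_whp]
  simpa only [not_lt] using h η hη

lemma IsBigOInProb.mono {X : ℕ → Ω → ℝ≥0∞} {a a' : ℕ → ℝ} (h : IsBigOInProb P X a)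
    (ha : ∀ n, a n ≤ a' n) : IsBigOInProb P X a' := by
  intro δ hδ
  obtain ⟨K, hK, hn⟩ := h δ hδ
  refine ⟨K, hK, hn.mono fun n hn => (measure_mono fun ω hω => ?_).trans hn⟩
  refine lt_of_le_of_lt (ENNReal.ofReal_le_ofReal ?_) hω
  exact mul_le_mul_of_nonneg_left (ha n) hK.le

/-- `X = O_p(a)` and `r a → 0` give `r X → 0` in probability. -/
lemma IsBigOInProb.eventually_whp {X : ℕ → Ω → ℝ≥0∞} {a : ℕ → ℝ} (h : IsBigOInProb P X a)
    {r : ℕ → ℝ} (hr : ∀ n, 0 ≤ r n) (hra : Tendsto (fun n => r n * a n) atTop (𝓝 0)) {η : ℝ}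
    (hη : 0 < η) : ∀ᶠ x in whp P, ENNReal.ofReal (r x.1) * X x.1 x.2 ≤ ENNReal.ofReal η := by
  refine eventually_whp_of_le fun δ hδ => ?_
  obtain ⟨K, hK, hn⟩ := h δ hδ
  have hlim : ∀ᶠ n in atTop, r n * a n ≤ η / K :=
    (hra.eventually (gt_mem_nhds (div_pos hη hK))).mono fun _ h => le_of_lt h
  filter_upwards [hn, hlim] with n hn hl
  refine (measure_mono ?_).trans hn
  intro ω hω
  simp only [Set.mem_ofPred_eq, not_le] at hω ⊢
  by_contra hX
  push Not at hX
  refine absurd hω (not_lt.2 ?_)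
  calc ENNReal.ofReal (r n) * X n ω ≤ ENNReal.ofReal (r n) * ENNReal.ofReal (K * a n) := by gcongr
    _ = ENNReal.ofReal (K * (r n * a n)) := by
      rw [← ENNReal.ofReal_mul (hr n)]; ring_nf
    _ ≤ ENNReal.ofReal η := by
      refine ENNReal.ofReal_le_ofReal ?_
      calc K * (r n * a n) ≤ K * (η / K) := by gcongr
        _ = η := by field_simp

end whp

/-! ### Sums over a fold, conditionally on the other folds -/

section conditional

variable {Ω : Type*} [MeasurableSpace Ω] {P : Measure Ω} [IsProbabilityMeasure P]

/-- Freezing lemma for probabilities: a bound on the probabilities of all sections of a measurable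
set is a bound on the probability that an independent pair falls into it. -/
lemma measure_le_of_indepFun {τ ν : Type*} [MeasurableSpace τ] [MeasurableSpace ν] {T : Ω → τ}
    {U : Ω → ν} (hT : Measurable T) (hU : Measurable U) (h : IndepFun T U P) {B : Set (τ × ν)}
    (hB : MeasurableSet B) {c : ℝ≥0∞} (hc : ∀ t, P {ω | (t, U ω) ∈ B} ≤ c) :
    P {ω | (T ω, U ω) ∈ B} ≤ c := by
  have := Measure.isProbabilityMeasure_map (μ := P) hT.aemeasurable
  have := Measure.isProbabilityMeasure_map (μ := P) hU.aemeasurable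
  have e : P {ω | (T ω, U ω) ∈ B} = P.map (fun ω => (T ω, U ω)) B := by
    rw [Measure.map_apply (hT.prodMk hU) hB]; rfl
  rw [e, (indepFun_iff_map_prod_eq_prod_map_map hT.aemeasurable hU.aemeasurable).1 h,
    Measure.prod_apply hB]
  calc ∫⁻ t, P.map U (Prod.mk t ⁻¹' B) ∂P.map T ≤ ∫⁻ _, c ∂P.map T := by
        refine lintegral_mono fun t => ?_
        rw [Measure.map_apply hU (measurable_prodMk_left hB)]
        exact hc t
    _ = c := by simp

variable {𝒲 : Type*} [MeasurableSpace 𝒲] {F : Measure 𝒲} [IsProbabilityMeasure F]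

/-- The fold sums of a function of the observation that depends on the data only through the
other folds, centred at its conditional mean: Chebyshev's inequality given the other folds. -/
lemma measure_abs_sum_sub_integral_le {τ ι : Type*} [MeasurableSpace τ] [Fintype ι]
    {T : Ω → τ} {U : ι → Ω → 𝒲} (hT : Measurable T) (hU : ∀ i, Measurable (U i))
    (hlaw : ∀ i, P.map (U i) = F) (hind : iIndepFun U P)
    (hTU : IndepFun T (fun ω i => U i ω) P)
    {f : τ → 𝒲 → ℝ} (hf : Measurable (Function.uncurry f)) {η a : ℝ} (hη : 0 ≤ η) (ha : 0 < a) :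
    P {ω | (∫⁻ w, ENNReal.ofReal (f (T ω) w ^ 2) ∂F ≤ ENNReal.ofReal η) ∧
        a ≤ |∑ i, (f (T ω) (U i ω) - ∫ w, f (T ω) w ∂F)|}
      ≤ ENNReal.ofReal (Fintype.card ι * η / a ^ 2) := by
  have hUm : Measurable fun ω i => U i ω := measurable_pi_lambda _ hU
  have hint : Measurable fun t => ∫ w, f t w ∂F :=
    (StronglyMeasurable.integral_prod_right (f := f) hf.stronglyMeasurable).measurable
  have hsq : Measurable fun t => ∫⁻ w, ENNReal.ofReal (f t w ^ 2) ∂F :=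
    Measurable.lintegral_prod_right' (f := fun x : τ × 𝒲 => ENNReal.ofReal (f x.1 x.2 ^ 2))
      ((hf.pow_const 2).ennreal_ofReal)
  let B : Set (τ × (ι → 𝒲)) := {x | (∫⁻ w, ENNReal.ofReal (f x.1 w ^ 2) ∂F ≤ ENNReal.ofReal η) ∧
    a ≤ |∑ i, (f x.1 (x.2 i) - ∫ w, f x.1 w ∂F)|}
  have hB : MeasurableSet B := by
    refine (measurableSet_le (hsq.comp measurable_fst) measurable_const).inter
      (measurableSet_le (g := fun x : τ × (ι → 𝒲) =>
        |∑ i, (f x.1 (x.2 i) - ∫ w, f x.1 w ∂F)|) measurable_const ?_)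
    have h : Measurable fun x : τ × (ι → 𝒲) => ∑ i, (f x.1 (x.2 i) - ∫ w, f x.1 w ∂F) := by
      refine Finset.measurable_sum _ fun i _ => Measurable.sub ?_ (hint.comp measurable_fst)
      exact hf.comp (measurable_fst.prodMk ((measurable_pi_apply i).comp measurable_snd))
    exact h.norm
  refine measure_le_of_indepFun hT hUm hTU hB fun t => ?_
  by_cases ht : ∫⁻ w, ENNReal.ofReal (f t w ^ 2) ∂F ≤ ENNReal.ofReal η
  swap
  · have : {ω | (t, fun i => U i ω) ∈ B} = ∅ := by
      ext ω; simp [B, ht]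
    simp [this]
  have hft : Measurable (f t) := hf.comp measurable_prodMk_left
  have hL2 : MemLp (f t) 2 F := by
    rw [memLp_two_iff_integrable_sq hft.aestronglyMeasurable]
    refine ⟨(hft.pow_const 2).aestronglyMeasurable, ?_⟩
    rw [hasFiniteIntegral_iff_ofReal (by filter_upwards with w using sq_nonneg _)]
    exact ht.trans_lt ENNReal.ofReal_lt_top
  have hsqle : ∫ w, f t w ^ 2 ∂F ≤ η := by
    rw [integral_eq_lintegral_of_nonneg_ae (by filter_upwards with w using sq_nonneg _)
      (hft.pow_const 2).aestronglyMeasurable]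
    exact ENNReal.toReal_le_of_le_ofReal hη ht
  have hmp : ∀ i, MeasurePreserving (U i) P F := fun i => ⟨hU i, hlaw i⟩
  have hXL2 : ∀ i, MemLp (fun ω => f t (U i ω)) 2 P := fun i => hL2.comp_measurePreserving (hmp i)
  have hXint : ∀ i, ∫ ω, f t (U i ω) ∂P = ∫ w, f t w ∂F := fun i => by
    rw [← hlaw i, integral_map (hU i).aemeasurable hft.aestronglyMeasurable]
  have hmean : ∫ ω, ∑ i, f t (U i ω) ∂P = ∑ _i : ι, ∫ w, f t w ∂F := by
    rw [integral_finsetSum _ fun i _ => (hXL2 i).integrable one_le_two]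
    exact Finset.sum_congr rfl fun i _ => hXint i
  have hvar : Var[fun ω => ∑ i, f t (U i ω); P] ≤ Fintype.card ι * η := by
    have h1 : Var[∑ i, fun ω => f t (U i ω); P] = ∑ i, Var[fun ω => f t (U i ω); P] :=
      IndepFun.variance_sum (fun i _ => hXL2 i) fun i _ j _ hij =>
        (hind.indepFun hij).comp hft hft
    have h2 : (fun ω => ∑ i, f t (U i ω)) = ∑ i, fun ω => f t (U i ω) := by
      ext ω; simp
    rw [h2, h1]
    calc ∑ i, Var[fun ω => f t (U i ω); P] ≤ ∑ _i : ι, η := by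
          refine Finset.sum_le_sum fun i _ => ?_
          refine (variance_le_expectation_sq (hXL2 i).1).trans ?_
          refine le_trans (le_of_eq ?_) hsqle
          rw [← hlaw i, integral_map (hU i).aemeasurable (hft.pow_const 2).aestronglyMeasurable]
          rfl
      _ = Fintype.card ι * η := by simp
  have hcheb := meas_ge_le_variance_div_sq (μ := P) (X := fun ω => ∑ i, f t (U i ω))
    (memLp_finsetSum _ fun i _ => hXL2 i) ha
  refine le_trans (measure_mono ?_) (hcheb.trans (ENNReal.ofReal_le_ofReal ?_))
  · intro ω hω
    have := hω.2
    simp only [Set.mem_ofPred_eq]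
    rw [hmean, ← Finset.sum_sub_distrib]
    exact this
  · gcongr

/-- Markov's inequality given the other folds, for the fold sum of the squares. -/
lemma measure_sum_sq_le {τ ι : Type*} [MeasurableSpace τ] [Fintype ι]
    {T : Ω → τ} {U : ι → Ω → 𝒲} (hT : Measurable T) (hU : ∀ i, Measurable (U i))
    (hlaw : ∀ i, P.map (U i) = F) (hTU : IndepFun T (fun ω i => U i ω) P)
    {f : τ → 𝒲 → ℝ} (hf : Measurable (Function.uncurry f)) {η a : ℝ} (ha : 0 < a) :
    P {ω | (∫⁻ w, ENNReal.ofReal (f (T ω) w ^ 2) ∂F ≤ ENNReal.ofReal η) ∧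
        a ≤ ∑ i, f (T ω) (U i ω) ^ 2}
      ≤ ENNReal.ofReal (Fintype.card ι * η / a) := by
  have hUm : Measurable fun ω i => U i ω := measurable_pi_lambda _ hU
  have hsq : Measurable fun t => ∫⁻ w, ENNReal.ofReal (f t w ^ 2) ∂F :=
    Measurable.lintegral_prod_right' (f := fun x : τ × 𝒲 => ENNReal.ofReal (f x.1 x.2 ^ 2))
      ((hf.pow_const 2).ennreal_ofReal)
  let B : Set (τ × (ι → 𝒲)) := {x | (∫⁻ w, ENNReal.ofReal (f x.1 w ^ 2) ∂F ≤ ENNReal.ofReal η) ∧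
    a ≤ ∑ i, f x.1 (x.2 i) ^ 2}
  have hB : MeasurableSet B := by
    refine (measurableSet_le (hsq.comp measurable_fst) measurable_const).inter
      (measurableSet_le (g := fun x : τ × (ι → 𝒲) => ∑ i, f x.1 (x.2 i) ^ 2)
        measurable_const ?_)
    refine Finset.measurable_sum _ fun i _ => Measurable.pow_const ?_ 2
    exact hf.comp (measurable_fst.prodMk ((measurable_pi_apply i).comp measurable_snd))
  refine measure_le_of_indepFun hT hUm hTU hB fun t => ?_
  by_cases ht : ∫⁻ w, ENNReal.ofReal (f t w ^ 2) ∂F ≤ ENNReal.ofReal η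
  swap
  · have : {ω | (t, fun i => U i ω) ∈ B} = ∅ := by
      ext ω; simp [B, ht]
    simp [this]
  have hft : Measurable (f t) := hf.comp measurable_prodMk_left
  have hmeas : ∀ i, Measurable fun ω => ENNReal.ofReal (f t (U i ω) ^ 2) := fun i =>
    ((hft.comp (hU i)).pow_const 2).ennreal_ofReal
  have hlint : ∫⁻ ω, ∑ i, ENNReal.ofReal (f t (U i ω) ^ 2) ∂P
      ≤ ENNReal.ofReal (Fintype.card ι * η) := by
    rw [lintegral_finsetSum _ fun i _ => hmeas i]
    calc ∑ i, ∫⁻ ω, ENNReal.ofReal (f t (U i ω) ^ 2) ∂P ≤ ∑ _i : ι, ENNReal.ofReal η := by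
          refine Finset.sum_le_sum fun i _ => ?_
          rw [← lintegral_map (f := fun w => ENNReal.ofReal (f t w ^ 2))
            (hft.pow_const 2).ennreal_ofReal (hU i), hlaw i]
          exact ht
      _ = ENNReal.ofReal (Fintype.card ι * η) := by
          rw [ENNReal.ofReal_mul (by positivity)]; simp
  calc P {ω | (t, fun i => U i ω) ∈ B}
      ≤ P {ω | ENNReal.ofReal a ≤ ∑ i, ENNReal.ofReal (f t (U i ω) ^ 2)} := by
        refine measure_mono fun ω hω => ?_
        simp only [Set.mem_ofPred_eq]
        rw [← ENNReal.ofReal_sum_of_nonneg fun i _ => sq_nonneg _]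
        exact ENNReal.ofReal_le_ofReal hω.2
    _ ≤ (∫⁻ ω, ∑ i, ENNReal.ofReal (f t (U i ω) ^ 2) ∂P) / ENNReal.ofReal a :=
        meas_ge_le_lintegral_div (Finset.measurable_sum _ fun i _ => hmeas i).aemeasurable
          (by simpa using ha) ENNReal.ofReal_ne_top
    _ ≤ ENNReal.ofReal (Fintype.card ι * η) / ENNReal.ofReal a := by gcongr
    _ = ENNReal.ofReal (Fintype.card ι * η / a) := (ENNReal.ofReal_div_of_pos ha).symm

end conditional

/-! ### The penalized GMM program: a deterministic `ℓ₁` bound -/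

section lasso

variable {p q : ℕ}

lemma sum_abs_le_rowSumNorm (A : Matrix (Fin q) (Fin q) ℝ) (i : Fin q) :
    ∑ j, |A i j| ≤ rowSumNorm A :=
  le_ciSup (f := fun i => ∑ j, |A i j|) (Set.finite_range _).bddAbove i

lemma rowSumNorm_nonneg (A : Matrix (Fin q) (Fin q) ℝ) : 0 ≤ rowSumNorm A :=
  Real.iSup_nonneg fun _ => Finset.sum_nonneg fun _ _ => abs_nonneg _

lemma rowSumNorm_le_add (A B : Matrix (Fin q) (Fin q) ℝ) :
    rowSumNorm A ≤ rowSumNorm (A - B) + rowSumNorm B := by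
  refine Real.iSup_le (fun i => ?_) (add_nonneg (rowSumNorm_nonneg _) (rowSumNorm_nonneg _))
  refine le_trans ?_ (add_le_add (sum_abs_le_rowSumNorm (A - B) i) (sum_abs_le_rowSumNorm B i))
  rw [← Finset.sum_add_distrib]
  refine Finset.sum_le_sum fun j _ => ?_
  have := abs_add_le (A i j - B i j) (B i j)
  simpa using this

/-- The bilinear form `x' (Ω / q) y`. -/
noncomputable def wform (Om : Matrix (Fin q) (Fin q) ℝ) (x y : Fin q → ℝ) : ℝ :=
  x ⬝ᵥ (scaledWeight Om *ᵥ y)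

lemma wform_add_right (Om : Matrix (Fin q) (Fin q) ℝ) (x y z : Fin q → ℝ) :
    wform Om x (y + z) = wform Om x y + wform Om x z := by
  simp [wform, Matrix.mulVec_add, dotProduct_add]

lemma wform_add_left (Om : Matrix (Fin q) (Fin q) ℝ) (x y z : Fin q → ℝ) :
    wform Om (x + y) z = wform Om x z + wform Om y z := by
  simp [wform, add_dotProduct]

lemma wform_smul_left (Om : Matrix (Fin q) (Fin q) ℝ) (a : ℝ) (x y : Fin q → ℝ) :
    wform Om (a • x) y = a * wform Om x y := by
  simp [wform, smul_dotProduct]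

lemma wform_smul_right (Om : Matrix (Fin q) (Fin q) ℝ) (a : ℝ) (x y : Fin q → ℝ) :
    wform Om x (a • y) = a * wform Om x y := by
  simp [wform, Matrix.mulVec_smul, dotProduct_smul]

lemma wform_sub_weight (Om Om' : Matrix (Fin q) (Fin q) ℝ) (x y : Fin q → ℝ) :
    wform (Om - Om') x y = wform Om x y - wform Om' x y := by
  simp [wform, scaledWeight, smul_sub, Matrix.sub_mulVec, dotProduct_sub]

lemma wform_comm {Om : Matrix (Fin q) (Fin q) ℝ} (h : Om.PosSemidef) (x y : Fin q → ℝ) :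
    wform Om x y = wform Om y x := by
  have hs : (scaledWeight Om)ᵀ = scaledWeight Om := by
    have : Omᵀ = Om := by
      rw [← Matrix.conjTranspose_eq_transpose_of_trivial]; exact h.isHermitian
    simp [scaledWeight, this]
  simp only [wform]
  rw [Matrix.dotProduct_mulVec, ← Matrix.mulVec_transpose, hs, dotProduct_comm]

lemma wform_self_nonneg {Om : Matrix (Fin q) (Fin q) ℝ} (h : Om.PosSemidef) (x : Fin q → ℝ) :
    0 ≤ wform Om x x := by
  have h1 : 0 ≤ x ⬝ᵥ (Om *ᵥ x) := by simpa using h.dotProduct_mulVec_nonneg x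
  simp only [wform, scaledWeight, Matrix.smul_mulVec, dotProduct_smul, smul_eq_mul]
  positivity

/-- Dividing by the dimension makes `Ω / q` bounded for the maximum norm by the row sum norm. -/
lemma abs_wform_le (Om : Matrix (Fin q) (Fin q) ℝ) {x y : Fin q → ℝ} {a c : ℝ} (ha : 0 ≤ a)
    (hc : 0 ≤ c) (hx : ∀ j, |x j| ≤ a) (hy : ∀ j, |y j| ≤ c) :
    |wform Om x y| ≤ rowSumNorm Om * a * c := by
  rcases Nat.eq_zero_or_pos q with rfl | hq
  · simp only [wform, dotProduct, Finset.univ_eq_empty, Finset.sum_empty, abs_zero]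
    have := rowSumNorm_nonneg Om
    positivity
  have hq' : (0 : ℝ) < q := by exact_mod_cast hq
  have hrow : ∀ j, |(Om *ᵥ y) j| ≤ rowSumNorm Om * c := fun j => by
    calc |(Om *ᵥ y) j| ≤ ∑ k, |Om j k * y k| :=
        Finset.abs_sum_le_sum_abs (fun k => Om j k * y k) Finset.univ
      _ ≤ ∑ k, |Om j k| * c := by
        refine Finset.sum_le_sum fun k _ => ?_
        rw [abs_mul]
        exact mul_le_mul_of_nonneg_left (hy k) (abs_nonneg _)
      _ = (∑ k, |Om j k|) * c := by rw [Finset.sum_mul]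
      _ ≤ rowSumNorm Om * c := mul_le_mul_of_nonneg_right (sum_abs_le_rowSumNorm Om j) hc
  have h1 : |x ⬝ᵥ (Om *ᵥ y)| ≤ q * (rowSumNorm Om * a * c) := by
    calc |x ⬝ᵥ (Om *ᵥ y)| ≤ ∑ j, |x j * (Om *ᵥ y) j| := Finset.abs_sum_le_sum_abs _ _
      _ ≤ ∑ _j : Fin q, a * (rowSumNorm Om * c) := by
        refine Finset.sum_le_sum fun j _ => ?_
        rw [abs_mul]
        exact mul_le_mul (hx j) (hrow j) (abs_nonneg _) ha
      _ = q * (rowSumNorm Om * a * c) := by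
        rw [Finset.sum_const, Finset.card_univ, Fintype.card_fin, nsmul_eq_mul]; ring
  simp only [wform, scaledWeight, Matrix.smul_mulVec, dotProduct_smul, smul_eq_mul]
  rw [abs_mul, abs_of_pos (inv_pos.2 hq'), inv_mul_le_iff₀ hq']
  exact h1

lemma abs_mulVec_le {G : Matrix (Fin q) (Fin p) ℝ} {B : ℝ} (hG : ∀ j k, |G j k| ≤ B)
    (δ : Fin p → ℝ) (j : Fin q) : |(G *ᵥ δ) j| ≤ B * ∑ k, |δ k| := by
  calc |(G *ᵥ δ) j| ≤ ∑ k, |G j k * δ k| :=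
      Finset.abs_sum_le_sum_abs (fun k => G j k * δ k) Finset.univ
    _ ≤ ∑ k, B * |δ k| := by
      refine Finset.sum_le_sum fun k _ => ?_
      rw [abs_mul]
      exact mul_le_mul_of_nonneg_right (hG j k) (abs_nonneg _)
    _ = B * ∑ k, |δ k| := by rw [Finset.mul_sum]

lemma dotProduct_gramG_mulVec (G : Matrix (Fin q) (Fin p) ℝ) (Om : Matrix (Fin q) (Fin q) ℝ)
    (δ : Fin p → ℝ) : δ ⬝ᵥ (gramG G Om *ᵥ δ) = wform Om (G *ᵥ δ) (G *ᵥ δ) := by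
  rw [gramG, ← Matrix.mulVec_mulVec, ← Matrix.mulVec_mulVec, Matrix.mulVec_transpose, wform,
    dotProduct_comm, ← Matrix.dotProduct_mulVec, dotProduct_comm]

/-- The basic inequality of the lasso, for the deviation of a minimizer from any other point. -/
lemma basic_inequality {M : Fin q → ℝ} {G : Matrix (Fin q) (Fin p) ℝ}
    {Om : Matrix (Fin q) (Fin q) ℝ} (hOm : Om.PosSemidef) {lam : ℝ} {ρh ρb : Fin p → ℝ}
    (hmin : IsMinOn (pgmmObjective M G Om lam) Set.univ ρh) :
    wform Om (G *ᵥ (ρh - ρb)) (G *ᵥ (ρh - ρb)) + 2 * lam * ∑ k, |ρh k|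
      ≤ 2 * wform Om (G *ᵥ (ρh - ρb)) (M - G *ᵥ ρb) + 2 * lam * ∑ k, |ρb k| := by
  have h := hmin (Set.mem_univ ρb)
  have hobj : ∀ ρ, pgmmObjective M G Om lam ρ
      = wform Om (M - G *ᵥ ρ) (M - G *ᵥ ρ) + 2 * lam * ∑ k, |ρ k| := fun ρ => rfl
  have hsplit : M - G *ᵥ ρh = (M - G *ᵥ ρb) + (-1 : ℝ) • (G *ᵥ (ρh - ρb)) := by
    rw [Matrix.mulVec_sub]; ext j; simp
  simp only [Set.mem_ofPred_eq, hobj] at h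
  rw [hsplit] at h
  simp only [wform_add_left, wform_add_right, wform_smul_left, wform_smul_right] at h
  rw [wform_comm hOm (M - G *ᵥ ρb) (G *ᵥ (ρh - ρb))] at h
  linarith

/-- If the score is below the penalty at a zero target, the minimizer is zero. -/
lemma eq_zero_of_score_lt {M : Fin q → ℝ} {G : Matrix (Fin q) (Fin p) ℝ}
    {Om : Matrix (Fin q) (Fin q) ℝ} (hOm : Om.PosSemidef) {lam B r : ℝ} {ρh : Fin p → ℝ}
    (hmin : IsMinOn (pgmmObjective M G Om lam) Set.univ ρh) (hB : 0 ≤ B) (hr : 0 ≤ r)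
    (hG : ∀ j k, |G j k| ≤ B) (hM : ∀ j, |M j| ≤ r) (hlt : rowSumNorm Om * B * r < lam) :
    ∑ k, |ρh k| = 0 := by
  have h := basic_inequality (ρb := 0) hOm hmin
  simp only [sub_zero, Matrix.mulVec_zero, Pi.zero_apply, abs_zero, Finset.sum_const_zero,
    mul_zero, add_zero] at h
  have h1 := wform_self_nonneg hOm (G *ᵥ ρh)
  have hs : 0 ≤ ∑ k, |ρh k| := Finset.sum_nonneg fun _ _ => abs_nonneg _
  have h2 := (abs_le.1 (abs_wform_le Om (by positivity) hr (abs_mulVec_le hG ρh) hM)).2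
  by_contra hne
  have hpos : 0 < ∑ k, |ρh k| := lt_of_le_of_ne hs (Ne.symm hne)
  have h3 : rowSumNorm Om * (B * ∑ k, |ρh k|) * r < lam * ∑ k, |ρh k| := by
    calc rowSumNorm Om * (B * ∑ k, |ρh k|) * r = (rowSumNorm Om * B * r) * ∑ k, |ρh k| := by ring
      _ < lam * ∑ k, |ρh k| := mul_lt_mul_of_pos_right hlt hpos
  linarith

/-- Young's inequality for the semi-inner product given by a positive semidefinite weight. -/
lemma wform_le_quarter_add {Om : Matrix (Fin q) (Fin q) ℝ} (hOm : Om.PosSemidef)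
    (x y : Fin q → ℝ) : wform Om x y ≤ wform Om x x / 4 + wform Om y y := by
  have h := wform_self_nonneg hOm ((1 / 2 : ℝ) • x + (-1 : ℝ) • y)
  simp only [wform_add_left, wform_add_right, wform_smul_left, wform_smul_right] at h
  rw [wform_comm hOm y x] at h
  linarith

/-- Replacing the sample quantities `Ĝ, Ω̂` by `G, Ω` in the quadratic form costs a multiple of
`|δ|₁²` times the entrywise errors. -/
lemma wform_gram_sub_le {G G' : Matrix (Fin q) (Fin p) ℝ} {Om Om' : Matrix (Fin q) (Fin q) ℝ}
    {B C e : ℝ} (hB : 0 ≤ B) (he : 0 ≤ e) (hG : ∀ j k, |G j k| ≤ B)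
    (hG' : ∀ j k, |G' j k| ≤ B) (hd : ∀ j k, |G' j k - G j k| ≤ e) (hOm : rowSumNorm Om ≤ C)
    (hOm' : rowSumNorm Om' ≤ C) (hdO : rowSumNorm (Om' - Om) ≤ e) (δ : Fin p → ℝ) :
    wform Om (G *ᵥ δ) (G *ᵥ δ)
      ≤ wform Om' (G' *ᵥ δ) (G' *ᵥ δ) + (2 * B * C + B ^ 2) * e * (∑ k, |δ k|) ^ 2 := by
  set D := ∑ k, |δ k| with hD
  have hD0 : 0 ≤ D := Finset.sum_nonneg fun _ _ => abs_nonneg _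
  have hx := abs_mulVec_le hG δ
  have hx' := abs_mulVec_le hG' δ
  have hxd := abs_mulVec_le (G := G' - G) (B := e) (by simpa using hd) δ
  have hsplit : G' *ᵥ δ = G *ᵥ δ + (G' - G) *ᵥ δ := by rw [Matrix.sub_mulVec]; simp
  have key : wform Om' (G' *ᵥ δ) (G' *ᵥ δ) - wform Om (G *ᵥ δ) (G *ᵥ δ)
      = wform Om' ((G' - G) *ᵥ δ) (G' *ᵥ δ) + wform (Om' - Om) (G *ᵥ δ) (G' *ᵥ δ)
        + wform Om (G *ᵥ δ) ((G' - G) *ᵥ δ) := by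
    rw [wform_sub_weight]
    have e1 : wform Om' (G' *ᵥ δ) (G' *ᵥ δ)
        = wform Om' (G *ᵥ δ) (G' *ᵥ δ) + wform Om' ((G' - G) *ᵥ δ) (G' *ᵥ δ) := by
      rw [← wform_add_left, ← hsplit]
    have e2 : wform Om (G *ᵥ δ) (G' *ᵥ δ)
        = wform Om (G *ᵥ δ) (G *ᵥ δ) + wform Om (G *ᵥ δ) ((G' - G) *ᵥ δ) := by
      rw [← wform_add_right, ← hsplit]
    rw [e1, e2]; ring
  have b1 := (abs_le.1 (abs_wform_le Om' (by positivity) (by positivity) hxd hx')).1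
  have b2 := (abs_le.1 (abs_wform_le (Om' - Om) (by positivity) (by positivity) hx hx')).1
  have b3 := (abs_le.1 (abs_wform_le Om (by positivity) (by positivity) hx hxd)).1
  rw [← hD] at b1 b2 b3
  have c1 : rowSumNorm Om' * (e * D) * (B * D) ≤ C * (e * D) * (B * D) := by gcongr
  have c2 : rowSumNorm (Om' - Om) * (B * D) * (B * D) ≤ e * (B * D) * (B * D) := by gcongr
  have c3 : rowSumNorm Om * (B * D) * (e * D) ≤ C * (B * D) * (e * D) := by gcongr
  nlinarith [key, b1, b2, b3, c1, c2, c3]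

/-- The step from the slack basic inequality to the `ℓ₁` rate. Off the cone the quadratic form is
dropped and the penalty on the complement of the support absorbs everything but `s λ²`; in the
cone the restricted eigenvalue bound applies. -/
lemma l1_bound_of_slack_inequality {A : Matrix (Fin p) (Fin p) ℝ} {s : ℕ} {c lam Q : ℝ}
    (hc : 0 < c) (hlam : 0 < lam) (hRE : RestrictedEigenvalueGE A s c) {S : Finset (Fin p)}
    (hS : S.card ≤ s) (δ : Fin p → ℝ) (hQ : 0 ≤ Q)
    (hAQ : δ ⬝ᵥ (A *ᵥ δ) ≤ Q + lam * ∑ k, |δ k|)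
    (hbasic : Q / 2 + 2 * lam * ∑ k ∈ Sᶜ, |δ k|
      ≤ 2 * lam * ∑ k ∈ S, |δ k| + lam / 4 * ∑ k, |δ k| + s * lam ^ 2) :
    ∑ k, |δ k| ≤ (4 + 32 / c) * (s * lam) := by
  have hsplit : ∑ k, |δ k| = ∑ k ∈ S, |δ k| + ∑ k ∈ Sᶜ, |δ k| :=
    (Finset.sum_add_sum_compl S _).symm
  set a := ∑ k ∈ S, |δ k| with ha_def
  set a' := ∑ k ∈ Sᶜ, |δ k| with ha'_def
  have ha : 0 ≤ a := Finset.sum_nonneg fun _ _ => abs_nonneg _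
  have hs0 : (0 : ℝ) ≤ s := Nat.cast_nonneg s
  have hsl : 0 ≤ s * lam := by positivity
  rw [hsplit] at hAQ hbasic ⊢
  have h32 : 0 ≤ 32 / c * (s * lam) := by positivity
  by_cases hcone : a' ≤ 3 * a
  swap
  · push Not at hcone
    have h1 : lam * (2 * a') ≤ lam * (2 * a + (a + a') / 4 + s * lam) := by nlinarith
    have h2 := le_of_mul_le_mul_left h1 hlam
    nlinarith
  by_cases hδ : δ = 0
  · have e1 : a = 0 := by simp [ha_def, hδ]
    have e2 : a' = 0 := by simp [ha'_def, hδ]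
    rw [e1, e2]; simp; positivity
  have hre := hRE S δ hS hδ hcone
  have hX : 0 < ∑ k ∈ S, δ k ^ 2 := by
    refine lt_of_le_of_ne (Finset.sum_nonneg fun _ _ => sq_nonneg _) fun h0 => ?_
    rw [← h0, div_zero] at hre
    exact absurd hre (not_le.2 hc)
  have hre' := (le_div_iff₀ hX).1 hre
  have hCS : a ^ 2 ≤ s * ∑ k ∈ S, δ k ^ 2 := by
    have h := sq_sum_le_card_mul_sum_sq (s := S) (f := fun k => |δ k|)
    simp only [sq_abs] at h
    have hScard : (S.card : ℝ) ≤ s := by exact_mod_cast hS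
    exact h.trans (mul_le_mul_of_nonneg_right hScard hX.le)
  -- In the cone `|δ|₁ ≤ 4 a`, so that `c a² ≤ s (8 λ a + 2 s λ²)`.
  have hquad : c * a ^ 2 ≤ (s * lam) * (8 * a + 2 * (s * lam)) := by
    have e1 : lam * a' ≤ lam * (3 * a) := mul_le_mul_of_nonneg_left hcone hlam.le
    have h0 : 0 ≤ lam * a := by positivity
    have h0' : 0 ≤ lam * a' :=
      mul_nonneg hlam.le (Finset.sum_nonneg fun _ _ => abs_nonneg _)
    have e2 : δ ⬝ᵥ (A *ᵥ δ) ≤ 8 * (lam * a) + 2 * (s * lam ^ 2) := by nlinarith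
    calc c * a ^ 2 ≤ s * (c * ∑ k ∈ S, δ k ^ 2) := by nlinarith
      _ ≤ s * (8 * (lam * a) + 2 * (s * lam ^ 2)) := by gcongr; exact hre'.trans e2
      _ = (s * lam) * (8 * a + 2 * (s * lam)) := by ring
  have hfin : a ≤ (1 + 8 / c) * (s * lam) := by
    by_contra hlt
    push Not at hlt
    set u := (s : ℝ) * lam with hu
    have hcu : c * ((1 + 8 / c) * u) = (c + 8) * u := by field_simp
    have h2 : (c + 8) * u < c * a := by rw [← hcu]; exact mul_lt_mul_of_pos_left hlt hc
    have ha_pos : 0 < a := lt_of_le_of_lt (by positivity) hlt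
    have hua : u ≤ a := by
      have : 0 ≤ 8 / c * u := by positivity
      nlinarith
    have h3 : (c + 8) * u * a < c * a * a := mul_lt_mul_of_pos_right h2 ha_pos
    have h4 : c * a * a ≤ u * (8 * a + 2 * u) := by nlinarith
    have h5 : u * (2 * u) ≤ u * (c * a) := by
      refine mul_le_mul_of_nonneg_left ?_ hsl
      nlinarith
    nlinarith
  have h4 : (4 + 32 / c) * (s * lam) = 4 * ((1 + 8 / c) * (s * lam)) := by ring
  linarith

/-- The `ℓ₁` rate of the penalized GMM program when the sample moments and the weight are within
`η λ` of their population counterparts and the approximation error of the population moment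
equations is at most `η √s λ`. The latter may exceed the penalty, so it is not treated as part of
the score; it is split off by the Cauchy-Schwarz inequality for the weight `Ω̂` and costs only
`s λ²`. -/
lemma l1_bound_of_isMinOn {M Mh : Fin q → ℝ} {G Gh : Matrix (Fin q) (Fin p) ℝ}
    {Om Omh : Matrix (Fin q) (Fin q) ℝ} (hOmh : Omh.PosSemidef) {lam : ℝ} {ρh ρb : Fin p → ℝ}
    (hmin : IsMinOn (pgmmObjective Mh Gh Omh lam) Set.univ ρh) {s : ℕ} {c A B C η : ℝ}
    (hc : 0 < c) (hlam : 0 < lam) (hB : 0 ≤ B) (hη : 0 ≤ η) (hslam : s * lam ≤ 1)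
    (hsupp : (Finset.univ.filter fun k => ρb k ≠ 0).card ≤ s) (hA : ∑ k, |ρb k| ≤ A)
    (hRE : RestrictedEigenvalueGE (gramG G Om) s c)
    (hG : ∀ j k, |G j k| ≤ B) (hGh : ∀ j k, |Gh j k| ≤ B)
    (hOmC : rowSumNorm Om ≤ C) (hOmhC : rowSumNorm Omh ≤ C)
    (hdG : ∀ j k, |Gh j k - G j k| ≤ η * lam) (hdOm : rowSumNorm (Omh - Om) ≤ η * lam)
    (hdM : ∀ j, |Mh j - M j| ≤ η * lam) (happ : ∀ j, |(M - G *ᵥ ρb) j| ≤ η * √s * lam)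
    (hη1 : 8 * B * C * (1 + A) * η ≤ 1) (hη2 : 2 * C * η ^ 2 ≤ 1)
    (hη3 : (2 * B * C + B ^ 2) * (4 * A + 1) * η ≤ 1) :
    ∑ k, |ρh k - ρb k| ≤ (4 + 32 / c) * (s * lam) := by
  have hA0 : 0 ≤ A := le_trans (Finset.sum_nonneg fun _ _ => abs_nonneg _) hA
  have hC0 : 0 ≤ C := (rowSumNorm_nonneg _).trans hOmC
  set δ := ρh - ρb with hδ
  set D := ∑ k, |δ k| with hD
  have hD0 : 0 ≤ D := Finset.sum_nonneg fun _ _ => abs_nonneg _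
  have hs0 : (0 : ℝ) ≤ s := Nat.cast_nonneg s
  set Q := wform Omh (Gh *ᵥ δ) (Gh *ᵥ δ) with hQ
  have hQ0 : 0 ≤ Q := wform_self_nonneg hOmh _
  set e := M - G *ᵥ ρb with he
  set u := (Mh - M) + (G - Gh) *ᵥ ρb with hu
  have hv : Mh - Gh *ᵥ ρb = e + u := by
    rw [he, hu, Matrix.sub_mulVec]; ext j; simp; ring
  have hu_le : ∀ j, |u j| ≤ η * lam * (1 + A) := fun j => by
    have h1 := abs_mulVec_le (G := G - Gh) (B := η * lam)
      (fun j k => by rw [Matrix.sub_apply, abs_sub_comm]; exact hdG j k) ρb j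
    have h2 : η * lam * ∑ k, |ρb k| ≤ η * lam * A := by gcongr
    calc |u j| ≤ |Mh j - M j| + |((G - Gh) *ᵥ ρb) j| := abs_add_le _ _
      _ ≤ η * lam + η * lam * A := add_le_add (hdM j) (h1.trans h2)
      _ = η * lam * (1 + A) := by ring
  have hbasic := basic_inequality (ρb := ρb) hOmh hmin
  rw [← hδ, hv, wform_add_right, ← hQ] at hbasic
  have hscore : 2 * wform Omh (Gh *ᵥ δ) u ≤ lam / 4 * D := by
    have h := (abs_le.1 (abs_wform_le Omh (by positivity) (by positivity)
      (abs_mulVec_le hGh δ) hu_le)).2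
    rw [← hD] at h
    have h2 : rowSumNorm Omh * (B * D) * (η * lam * (1 + A))
        ≤ C * (B * D) * (η * lam * (1 + A)) := by gcongr
    have h3 : 8 * B * C * (1 + A) * η * (lam * D) ≤ 1 * (lam * D) := by gcongr
    nlinarith
  have happ' : 2 * wform Omh (Gh *ᵥ δ) e ≤ Q / 2 + s * lam ^ 2 := by
    have h := wform_le_quarter_add hOmh (Gh *ᵥ δ) e
    have h1 := (abs_le.1 (abs_wform_le Omh (by positivity) (by positivity) happ happ)).2
    have h2 : rowSumNorm Omh * (η * √s * lam) * (η * √s * lam)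
        ≤ C * (η * √s * lam) * (η * √s * lam) := by gcongr
    have h3 : C * (η * √s * lam) * (η * √s * lam) = C * η ^ 2 * (s * lam ^ 2) := by
      rw [← Real.sq_sqrt hs0]; simp only [Real.sqrt_sq (Real.sqrt_nonneg _)]; ring
    have h4 : 2 * C * η ^ 2 * (s * lam ^ 2) ≤ 1 * (s * lam ^ 2) := by gcongr
    rw [← hQ] at h
    nlinarith
  have hmain : Q / 2 + 2 * lam * ∑ k, |ρh k|
      ≤ 2 * lam * ∑ k, |ρb k| + lam / 4 * D + s * lam ^ 2 := by linarith
  have hD_le : D ≤ ∑ k, |ρh k| + ∑ k, |ρb k| := by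
    rw [hD, ← Finset.sum_add_distrib]
    exact Finset.sum_le_sum fun k _ => abs_sub _ _
  -- The `ℓ₁` norm of `δ` is bounded, so that `|δ|₁²` is of the order of `|δ|₁`.
  have hDbdd : D ≤ 4 * A + 1 := by
    have h1 : lam * (2 * ∑ k, |ρh k|) ≤ lam * (2 * A + D / 4 + 1) := by
      have : s * lam ^ 2 ≤ lam := by nlinarith
      have : lam * ∑ k, |ρb k| ≤ lam * A := by gcongr
      nlinarith
    have h2 := le_of_mul_le_mul_left h1 hlam
    linarith
  set S := Finset.univ.filter fun k => ρb k ≠ 0 with hS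
  refine l1_bound_of_slack_inequality hc hlam hRE hsupp δ hQ0 ?_ ?_
  · rw [dotProduct_gramG_mulVec]
    refine (wform_gram_sub_le hB (by positivity) hG hGh hdG hOmC hOmhC hdOm δ).trans ?_
    rw [← hD, ← hQ]
    have h1 : (2 * B * C + B ^ 2) * (η * lam) * D ^ 2
        ≤ ((2 * B * C + B ^ 2) * (4 * A + 1) * η) * (lam * D) := by
      calc (2 * B * C + B ^ 2) * (η * lam) * D ^ 2
          = ((2 * B * C + B ^ 2) * η * (lam * D)) * D := by ring
        _ ≤ ((2 * B * C + B ^ 2) * η * (lam * D)) * (4 * A + 1) := by gcongr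
        _ = _ := by ring
    have h2 : ((2 * B * C + B ^ 2) * (4 * A + 1) * η) * (lam * D) ≤ 1 * (lam * D) := by gcongr
    linarith
  · have hsum : ∀ f : Fin p → ℝ, ∑ k, f k = ∑ k ∈ S, f k + ∑ k ∈ Sᶜ, f k := fun f =>
      (Finset.sum_add_sum_compl S f).symm
    have hzero : ∀ k ∈ Sᶜ, ρb k = 0 := fun k hk => by simpa [hS] using hk
    have h1 : ∑ k ∈ Sᶜ, |ρb k| = 0 := Finset.sum_eq_zero fun k hk => by simp [hzero k hk]
    have h2 : ∑ k ∈ Sᶜ, |ρh k| = ∑ k ∈ Sᶜ, |δ k| :=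
      Finset.sum_congr rfl fun k hk => by simp [hδ, hzero k hk]
    have h3 : ∑ k ∈ S, |ρb k| ≤ ∑ k ∈ S, |ρh k| + ∑ k ∈ S, |δ k| := by
      rw [← Finset.sum_add_distrib]
      refine Finset.sum_le_sum fun k _ => ?_
      have := abs_sub (ρh k) (δ k)
      simpa [hδ] using this
    rw [hsum fun k => |ρh k|, hsum fun k => |ρb k|, h1, h2] at hmain
    have h4 := mul_le_mul_of_nonneg_left h3 (by positivity : 0 ≤ 2 * lam)
    nlinarith

end lasso

/-! ### Uniform concentration of the sample moments of bounded dictionaries -/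

section concentration

variable {Ω : Type*} [MeasurableSpace Ω] {P : Measure Ω} [IsProbabilityMeasure P]

/-- Hoeffding's inequality for the mean of a bounded function of i.i.d. observations. -/
lemma measure_abs_mean_sub_gt_le {𝒲 ι : Type*} [MeasurableSpace 𝒲] {F : Measure 𝒲}
    [IsProbabilityMeasure F] [Fintype ι] [Nonempty ι] {U : ι → Ω → 𝒲}
    (hU : ∀ i, Measurable (U i)) (hlaw : ∀ i, P.map (U i) = F) (hind : iIndepFun U P)
    {g : 𝒲 → ℝ} (hg : Measurable g) {B : ℝ} (hB : 0 < B) (hgB : ∀ᵐ w ∂F, |g w| ≤ B)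
    {t : ℝ} (ht : 0 ≤ t) :
    P {ω | t < |(Fintype.card ι : ℝ)⁻¹ * ∑ i, g (U i ω) - ∫ w, g w ∂F|}
      ≤ ENNReal.ofReal (2 * Real.exp (-(Fintype.card ι * t ^ 2 / (2 * B ^ 2)))) := by
  have hN : (0 : ℝ) < Fintype.card ι := by exact_mod_cast Fintype.card_pos
  set N : ℝ := (Fintype.card ι : ℝ) with hN_def
  have hint : ∀ i, ∫ ω, g (U i ω) ∂P = ∫ w, g w ∂F := fun i => by
    rw [← hlaw i, integral_map (hU i).aemeasurable hg.aestronglyMeasurable]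
  have hsub : ∀ i, HasSubgaussianMGF (fun ω => g (U i ω) - ∫ w, g w ∂F)
      ((‖B - -B‖₊ / 2) ^ 2) P := fun i => by
    rw [← hint i]
    refine hasSubgaussianMGF_of_mem_Icc (hg.comp (hU i)).aemeasurable ?_
    have : ∀ᵐ w ∂P.map (U i), |g w| ≤ B := by rw [hlaw i]; exact hgB
    filter_upwards [ae_of_ae_map (hU i).aemeasurable this] with ω hω
    exact abs_le.1 hω
  have hindX : iIndepFun (fun i ω => g (U i ω) - ∫ w, g w ∂F) P :=
    hind.comp (fun _ w => g w - ∫ w, g w ∂F) fun _ => hg.sub_const _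
  have hsum := HasSubgaussianMGF.sum_of_iIndepFun hindX (s := Finset.univ) fun i _ => hsub i
  have hc : ((∑ _i : ι, (‖B - -B‖₊ / 2) ^ 2 : NNReal) : ℝ) = N * B ^ 2 := by
    have h2 : |B + B| = 2 * B := by rw [abs_of_pos (by linarith)]; ring
    simp [hN_def, h2]
  have hexp : ∀ Z : Ω → ℝ, HasSubgaussianMGF Z (∑ _i : ι, (‖B - -B‖₊ / 2) ^ 2) P →
      P {ω | N * t ≤ Z ω} ≤ ENNReal.ofReal (Real.exp (-(N * t ^ 2 / (2 * B ^ 2)))) := by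
    intro Z hZ
    have h := hZ.measure_ge_le (ε := N * t) (by positivity)
    rw [hc] at h
    have he : -(N * t) ^ 2 / (2 * (N * B ^ 2)) = -(N * t ^ 2 / (2 * B ^ 2)) := by
      field_simp
    rw [he] at h
    rw [← ofReal_measureReal]
    exact ENNReal.ofReal_le_ofReal h
  have h1 := hexp _ hsum
  have h2 := hexp _ hsum.neg
  rw [two_mul, ENNReal.ofReal_add (by positivity) (by positivity)]
  refine le_trans (measure_mono ?_) ((measure_union_le _ _).trans (add_le_add h1 h2))
  intro ω hω
  simp only [Set.mem_ofPred_eq] at hω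
  have hS : ∑ i, (g (U i ω) - ∫ w, g w ∂F)
      = N * (N⁻¹ * ∑ i, g (U i ω) - ∫ w, g w ∂F) := by
    rw [Finset.sum_sub_distrib, mul_sub, ← mul_assoc, mul_inv_cancel₀ hN.ne']
    simp [hN_def]
  simp only [Set.mem_union, Set.mem_ofPred_eq, Pi.neg_apply, hS]
  rcases lt_abs.1 hω with h | h
  · exact Or.inl (mul_le_mul_of_nonneg_left h.le hN.le)
  · right
    have := mul_le_mul_of_nonneg_left h.le hN.le
    linarith

variable {𝒳 𝒵 : Type*} [MeasurableSpace 𝒳] [MeasurableSpace 𝒵]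
  {F₀ : Measure (Obs 𝒳 𝒵)} [IsProbabilityMeasure F₀]

lemma measure_sampleG_sub_popG_gt_le {ι : Type*} [Fintype ι] [Nonempty ι]
    {U : ι → Ω → Obs 𝒳 𝒵} (hU : ∀ i, Measurable (U i)) (hlaw : ∀ i, P.map (U i) = F₀)
    (hind : iIndepFun U P) {p q : ℕ} (hpq : p ≤ q) {d : Fin q → 𝒳 → ℝ} {b : Fin p → 𝒵 → ℝ}
    (hd : ∀ j, Measurable (d j)) (hb : ∀ k, Measurable (b k)) {B : ℝ} (hB : 0 < B)
    (hdb : ∀ᵐ w ∂F₀, ∀ j k, |d j w.x * b k w.z| ≤ B) {t : ℝ} (ht : 0 ≤ t) :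
    P {ω | ¬ ∀ j k, |sampleG d b (fun i => U i ω) j k - popG F₀ d b j k| ≤ t}
      ≤ ENNReal.ofReal (2 * q ^ 2 * Real.exp (-(Fintype.card ι * t ^ 2 / (2 * B ^ 2)))) := by
  obtain ⟨E, hE⟩ : ∃ E, E = 2 * Real.exp (-(Fintype.card ι * t ^ 2 / (2 * B ^ 2))) := ⟨_, rfl⟩
  have hE0 : 0 ≤ E := by rw [hE]; positivity
  have h1 : ∀ j k, P {ω | t < |sampleG d b (fun i => U i ω) j k - popG F₀ d b j k|}
      ≤ ENNReal.ofReal E := fun j k => hE ▸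
    measure_abs_mean_sub_gt_le (g := fun w : Obs 𝒳 𝒵 => d j w.x * b k w.z) hU hlaw hind
      (((hd j).comp (measurable_fst.comp measurable_snd)).mul
        ((hb k).comp (measurable_snd.comp measurable_snd))) hB
      (by filter_upwards [hdb] with w hw using hw j k) ht
  calc P {ω | ¬ ∀ j k, |sampleG d b (fun i => U i ω) j k - popG F₀ d b j k| ≤ t}
      ≤ P (⋃ j, ⋃ k, {ω | t < |sampleG d b (fun i => U i ω) j k - popG F₀ d b j k|}) := by
        refine measure_mono fun ω hω => ?_
        simp only [Set.mem_ofPred_eq, not_forall, not_le] at hω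
        simpa only [Set.mem_iUnion, Set.mem_ofPred_eq] using hω
    _ ≤ ∑ j : Fin q, ∑ k : Fin p, ENNReal.ofReal E :=
        (measure_iUnion_fintype_le _ _).trans (Finset.sum_le_sum fun j _ =>
          (measure_iUnion_fintype_le _ _).trans (Finset.sum_le_sum fun k _ => h1 j k))
    _ = ENNReal.ofReal (q * (p * E)) := by
        rw [ENNReal.ofReal_mul (by positivity), ENNReal.ofReal_mul (by positivity)]; simp
    _ ≤ ENNReal.ofReal (2 * q ^ 2 * Real.exp (-(Fintype.card ι * t ^ 2 / (2 * B ^ 2)))) := by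
        refine ENNReal.ofReal_le_ofReal ?_
        have hpq' : (p : ℝ) ≤ q := by exact_mod_cast hpq
        calc (q : ℝ) * (p * E) ≤ q * (q * E) := by gcongr
          _ = _ := by rw [hE]; ring

lemma epsG_nonneg (q : ℕ → ℕ) (n : ℕ) : 0 ≤ epsG q n := Real.sqrt_nonneg _

lemma epsG_le_epsMax (q : ℕ → ℕ) (εM : ℕ → ℝ) (n : ℕ) : epsG q n ≤ epsMax q εM n :=
  le_max_left _ _

lemma epsMax_nonneg (q : ℕ → ℕ) (εM : ℕ → ℝ) (n : ℕ) : 0 ≤ epsMax q εM n :=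
  (epsG_nonneg q n).trans (epsG_le_epsMax q εM n)

/-- With `√(log q / n) = o(λ)`, the union bound over the at most `q²` entries shows that the sample
moments `Ĝ` over at least `n / 4` observations are entrywise within `η λ` of `G`. -/
lemma eventually_whp_sampleG_sub_popG_le {ι : ℕ → Type*} [∀ n, Fintype (ι n)]
    {U : (n : ℕ) → ι n → Ω → Obs 𝒳 𝒵} (hU : ∀ n i, Measurable (U n i))
    (hlaw : ∀ n i, P.map (U n i) = F₀) (hind : ∀ n, iIndepFun (U n) P)
    (hcard : ∀ᶠ n : ℕ in atTop, (n : ℝ) / 4 ≤ Fintype.card (ι n))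
    {p q : ℕ → ℕ} (hpq : ∀ n, p n ≤ q n) (hq : ∀ n, 2 ≤ q n)
    {d : (n : ℕ) → Fin (q n) → 𝒳 → ℝ} {b : (n : ℕ) → Fin (p n) → 𝒵 → ℝ}
    (hd : ∀ n j, Measurable (d n j)) (hb : ∀ n k, Measurable (b n k)) {B : ℝ} (hB : 0 < B)
    (hdb : ∀ᶠ n in atTop, ∀ᵐ w ∂F₀, ∀ j k, |d n j w.x * b n k w.z| ≤ B)
    {lam : ℕ → ℝ} (hlam : ∀ n, 0 < lam n) (hrate : epsG q =o[atTop] lam) {η : ℝ} (hη : 0 < η) :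
    ∀ᶠ x in whp P, ∀ j k,
      |sampleG (d x.1) (b x.1) (fun i => U x.1 i x.2) j k - popG F₀ (d x.1) (b x.1) j k|
        ≤ η * lam x.1 := by
  refine eventually_whp_of_le fun δ hδ => ?_
  have hlog2 : 0 < Real.log 2 := Real.log_pos one_lt_two
  -- `y` is the excess of the exponent over the union bound.
  obtain ⟨y, hy0, hy⟩ : ∃ y : ℝ, 0 ≤ y ∧ 2 * Real.exp (-(y * Real.log 2)) ≤ δ := by
    have h : Tendsto (fun y : ℝ => 2 * Real.exp (-(y * Real.log 2))) atTop (𝓝 (2 * 0)) :=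
      (Real.tendsto_exp_neg_atTop_nhds_zero.comp
        (tendsto_id.atTop_mul_const hlog2)).const_mul 2
    rw [mul_zero] at h
    obtain ⟨y, h1, h2⟩ := ((h.eventually (gt_mem_nhds hδ)).and (eventually_ge_atTop 0)).exists
    exact ⟨y, h2, h1.le⟩
  set K : ℝ := √(8 * B ^ 2 * (2 + y)) / η with hK
  have hKpos : 0 < K := by positivity
  have hrate' := hrate.bound (inv_pos.2 hKpos)
  filter_upwards [hcard, hdb, hrate', eventually_gt_atTop 0] with n hn hdbn hr hn0
  have hn0' : (0 : ℝ) < n := by exact_mod_cast hn0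
  have hNpos : (0 : ℝ) < Fintype.card (ι n) := lt_of_lt_of_le (by positivity) hn
  have : Nonempty (ι n) := Fintype.card_pos_iff.1 (by exact_mod_cast hNpos)
  refine (measure_sampleG_sub_popG_gt_le (hU n) (hlaw n) (hind n) (hpq n) (hd n) (hb n) hB hdbn
    (mul_pos hη (hlam n)).le).trans (ENNReal.ofReal_le_ofReal ?_)
  have hqpos : (0 : ℝ) < q n := by have := hq n; positivity
  have hlogq : Real.log 2 ≤ Real.log (q n) :=
    Real.log_le_log two_pos (by exact_mod_cast hq n)
  have hKe : K * epsG q n ≤ lam n := by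
    rw [Real.norm_of_nonneg (epsG_nonneg q n), Real.norm_of_nonneg (hlam n).le] at hr
    rwa [le_inv_mul_iff₀ hKpos] at hr
  have hsq : (8 * B ^ 2 * (2 + y)) * (Real.log (q n) / n) ≤ (η * lam n) ^ 2 := by
    have h1 : (η * (K * epsG q n)) ^ 2 ≤ (η * lam n) ^ 2 := by
      have := epsG_nonneg q n
      gcongr
    refine le_trans (le_of_eq ?_) h1
    have h2 : η * (K * epsG q n) = √(8 * B ^ 2 * (2 + y)) * epsG q n := by
      rw [hK]; field_simp
    rw [h2, mul_pow, Real.sq_sqrt (by positivity), epsG,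
      Real.sq_sqrt (div_nonneg (hlog2.le.trans hlogq) hn0'.le)]
  have hexp : (2 + y) * Real.log (q n)
      ≤ Fintype.card (ι n) * (η * lam n) ^ 2 / (2 * B ^ 2) := by
    rw [le_div_iff₀ (by positivity)]
    calc (2 + y) * Real.log (q n) * (2 * B ^ 2)
        = n / 4 * ((8 * B ^ 2 * (2 + y)) * (Real.log (q n) / n)) := by field_simp; ring
      _ ≤ Fintype.card (ι n) * (η * lam n) ^ 2 := by gcongr
  calc 2 * (q n : ℝ) ^ 2 * Real.exp (-(Fintype.card (ι n) * (η * lam n) ^ 2 / (2 * B ^ 2)))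
      ≤ 2 * (q n : ℝ) ^ 2 * Real.exp (-((2 + y) * Real.log (q n))) := by gcongr
    _ = 2 * Real.exp (-(y * Real.log (q n))) := by
        have h : (q n : ℝ) ^ 2 = Real.exp (2 * Real.log (q n)) := by
          rw [two_mul, Real.exp_add, Real.exp_log hqpos, sq]
        rw [h, mul_assoc, ← Real.exp_add]; ring_nf
    _ ≤ 2 * Real.exp (-(y * Real.log 2)) := by gcongr
    _ ≤ δ := hy

end concentration

/-! ### Population bounds: orthogonality and mean square error of the moment function -/

section population

lemma eLpNorm_two_sq {α : Type*} [MeasurableSpace α] {μ : Measure α} (g : α → ℝ) :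
    eLpNorm g 2 μ ^ 2 = ∫⁻ x, ENNReal.ofReal (g x ^ 2) ∂μ := by
  have h := eLpNorm_nnreal_pow_eq_lintegral (μ := μ) (f := g) (p := 2) two_ne_zero
  have e : ∀ x, ENNReal.ofReal (g x ^ 2) = ‖g x‖ₑ ^ 2 := fun x => by
    rw [Real.enorm_eq_ofReal_abs, ← ENNReal.ofReal_pow (abs_nonneg _), sq_abs]
  simp only [e]
  simpa using h

/-- The Cauchy-Schwarz inequality for the integral of a product. -/
lemma ofReal_abs_integral_mul_le {α : Type*} [MeasurableSpace α] {μ : Measure α} {f g : α → ℝ}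
    (hf : AEStronglyMeasurable f μ) (hg : AEStronglyMeasurable g μ) :
    ENNReal.ofReal |∫ x, f x * g x ∂μ| ≤ eLpNorm f 2 μ * eLpNorm g 2 μ := by
  rw [← Real.enorm_eq_ofReal_abs]
  calc ‖∫ x, f x * g x ∂μ‖ₑ ≤ ∫⁻ x, ‖f x * g x‖ₑ ∂μ := enorm_integral_le_lintegral_enorm _
    _ = eLpNorm (f • g) 1 μ := by rw [eLpNorm_one_eq_lintegral_enorm]; rfl
    _ ≤ eLpNorm f 2 μ * eLpNorm g 2 μ := eLpNorm_smul_le_mul_eLpNorm hg hf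

lemma stronglyMeasurable_sigmaZ {𝒳 𝒵 : Type*} [MeasurableSpace 𝒵] {a : 𝒵 → ℝ} (ha : Measurable a) :
    StronglyMeasurable[sigmaZ 𝒳 𝒵] fun w : Obs 𝒳 𝒵 => a w.z :=
  (ha.comp (comap_measurable _)).stronglyMeasurable

lemma psi_sub_psi {𝒳 𝒵 : Type*} {Γ : Submodule ℝ (𝒳 → ℝ)} {m : Obs 𝒳 𝒵 → Γ →ₗ[ℝ] ℝ}
    {γ γ₀ : Γ} {α α₀ : 𝒵 → ℝ} (w : Obs 𝒳 𝒵) :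
    psi m 0 γ α w - psi m 0 γ₀ α₀ w
      = (m w γ - m w γ₀) - α w.z * ((γ - γ₀ : Γ) : 𝒳 → ℝ) w.x
        + (α w.z - α₀ w.z) * (w.y - (γ₀ : 𝒳 → ℝ) w.x) := by
  simp only [psi, Submodule.coe_sub, Pi.sub_apply]; ring

lemma abs_linComb_le {𝒵 : Type*} {p : ℕ} {b : Fin p → 𝒵 → ℝ} {Cb : ℝ} {z : 𝒵}
    (h : ∀ k, |b k z| ≤ Cb) (ρ : Fin p → ℝ) :
    |linComb b ρ z| ≤ Cb * ∑ k, |ρ k| := by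
  rw [Finset.mul_sum]
  refine (Finset.abs_sum_le_sum_abs _ _).trans (Finset.sum_le_sum fun k _ => ?_)
  rw [abs_mul]
  exact mul_le_mul_of_nonneg_right (h k) (abs_nonneg _)

variable {𝒳 𝒵 : Type*} [MeasurableSpace 𝒳] [MeasurableSpace 𝒵]

lemma measurable_obs_x : Measurable fun w : Obs 𝒳 𝒵 => w.x := measurable_fst.comp measurable_snd

lemma measurable_obs_z : Measurable fun w : Obs 𝒳 𝒵 => w.z := measurable_snd.comp measurable_snd

lemma sigmaZ_le : sigmaZ 𝒳 𝒵 ≤ (inferInstance : MeasurableSpace (Obs 𝒳 𝒵)) :=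
  measurable_obs_z.comap_le

variable {F₀ : Measure (Obs 𝒳 𝒵)}

lemma memLp_top_comp_z {a : 𝒵 → ℝ} (ha : Measurable a) {R : ℝ}
    (haR : ∀ᵐ w ∂F₀, |a w.z| ≤ R) : MemLp (fun w : Obs 𝒳 𝒵 => a w.z) ∞ F₀ :=
  memLp_top_of_bound (ha.comp measurable_obs_z).aestronglyMeasurable R haR

variable [IsProbabilityMeasure F₀]

/-- Functions of the instruments see an integrable function only through its projection. -/
lemma integral_mul_condExp_sigmaZ {a : 𝒵 → ℝ} (ha : Measurable a) {R : ℝ}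
    (haR : ∀ᵐ w ∂F₀, |a w.z| ≤ R) {g : Obs 𝒳 𝒵 → ℝ} (hg : Integrable g F₀) :
    ∫ w, a w.z * g w ∂F₀ = ∫ w, a w.z * (F₀[g | sigmaZ 𝒳 𝒵]) w ∂F₀ := by
  have h := condExp_stronglyMeasurable_mul_of_bound sigmaZ_le (stronglyMeasurable_sigmaZ ha) hg R
    haR
  rw [← integral_condExp (sigmaZ_le (𝒳 := 𝒳) (𝒵 := 𝒵))]
  exact integral_congr_ae h

/-- A bounded conditional variance bounds the mean square of `a(Z) ε` by that of `a(Z)`. -/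
lemma lintegral_mul_sq_le_of_condExp_sq_le {a : 𝒵 → ℝ} (ha : Measurable a) {R : ℝ}
    (haR : ∀ᵐ w ∂F₀, |a w.z| ≤ R) {e : Obs 𝒳 𝒵 → ℝ} (he : MemLp e 2 F₀) {C : ℝ}
    (hC : F₀[fun w => e w ^ 2 | sigmaZ 𝒳 𝒵] ≤ᵐ[F₀] fun _ => C) :
    ∫⁻ w, ENNReal.ofReal ((a w.z * e w) ^ 2) ∂F₀ ≤ ENNReal.ofReal C * normZ F₀ a ^ 2 := by
  have haR2 : ∀ᵐ w ∂F₀, |a w.z ^ 2| ≤ R ^ 2 := by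
    filter_upwards [haR] with w hw
    rw [abs_pow]; gcongr
  have ha2 : Integrable (fun w : Obs 𝒳 𝒵 => a w.z ^ 2) F₀ :=
    (memLp_top_comp_z (ha.pow_const 2) haR2).integrable le_top
  have hint : Integrable (fun w => a w.z ^ 2 * e w ^ 2) F₀ :=
    he.integrable_sq.bdd_mul ((ha.pow_const 2).comp measurable_obs_z).aestronglyMeasurable haR2
  have h1 : ∫ w, a w.z ^ 2 * e w ^ 2 ∂F₀ ≤ ∫ w, C * a w.z ^ 2 ∂F₀ := by
    rw [integral_mul_condExp_sigmaZ (ha.pow_const 2) haR2 he.integrable_sq]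
    refine integral_mono_ae ?_ (ha2.const_mul C) ?_
    · exact integrable_condExp.bdd_mul
        ((ha.pow_const 2).comp measurable_obs_z).aestronglyMeasurable haR2
    · filter_upwards [hC] with w hw
      simp only [mul_comm C]
      exact mul_le_mul_of_nonneg_left hw (sq_nonneg _)
  rw [normZ, eLpNorm_two_sq,
    ← ofReal_integral_eq_lintegral_ofReal ha2 (ae_of_all _ fun _ => sq_nonneg _)]
  simp only [mul_pow]
  rw [← ofReal_integral_eq_lintegral_ofReal hint (ae_of_all _ fun _ => by positivity)]
  rw [integral_const_mul] at h1
  rw [← ENNReal.ofReal_mul' (integral_nonneg fun _ => sq_nonneg _)]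
  exact ENNReal.ofReal_le_ofReal h1

variable {Γ : Submodule ℝ (𝒳 → ℝ)} {m : Obs 𝒳 𝒵 → Γ →ₗ[ℝ] ℝ} {γ γ₀ : Γ} {α α₀ : 𝒵 → ℝ}

/-- Neyman orthogonality: the population moment at `(γ, α)` deviates from the one at the truth only
through the product of the error of `α` and the projected error of `γ`. -/
lemma ofReal_abs_integral_psi_sub_le
    (hΓ : ∀ γ ∈ Γ, Measurable γ ∧ MemLp (fun w : Obs 𝒳 𝒵 => γ w.x) 2 F₀)
    (h_exog : F₀[fun w : Obs 𝒳 𝒵 => w.y - (γ₀ : 𝒳 → ℝ) w.x | sigmaZ 𝒳 𝒵] =ᵐ[F₀] 0)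
    (h_err : MemLp (fun w : Obs 𝒳 𝒵 => w.y - (γ₀ : 𝒳 → ℝ) w.x) 2 F₀)
    (h_riesz : ∀ γ : Γ, Integrable (fun w => m w γ) F₀ ∧
      ∫ w, m w γ ∂F₀ = ∫ w : Obs 𝒳 𝒵, α₀ w.z * (γ : 𝒳 → ℝ) w.x ∂F₀)
    (hα₀ : Measurable α₀) {R₀ : ℝ} (hα₀R : ∀ᵐ w ∂F₀, |α₀ w.z| ≤ R₀)
    (hα : Measurable α) {R : ℝ} (hαR : ∀ᵐ w ∂F₀, |α w.z| ≤ R) :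
    ENNReal.ofReal |∫ w, (psi m 0 γ α w - psi m 0 γ₀ α₀ w) ∂F₀|
      ≤ normZ F₀ (fun z => α₀ z - α z) * projNorm F₀ (γ - γ₀ : Γ) := by
  have hdiff : Integrable (fun w : Obs 𝒳 𝒵 => ((γ - γ₀ : Γ) : 𝒳 → ℝ) w.x) F₀ :=
    (hΓ _ (γ - γ₀).2).2.integrable one_le_two
  have herr := h_err.integrable one_le_two
  have hαm := (hα.comp (measurable_obs_z (𝒳 := 𝒳) (𝒵 := 𝒵))).aestronglyMeasurable (μ := F₀)
  have hα₀m := (hα₀.comp (measurable_obs_z (𝒳 := 𝒳) (𝒵 := 𝒵))).aestronglyMeasurable (μ := F₀)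
  have hsubR : ∀ᵐ w : Obs 𝒳 𝒵 ∂F₀, |α w.z - α₀ w.z| ≤ R + R₀ := by
    filter_upwards [hαR, hα₀R] with w h1 h2
    exact (abs_sub _ _).trans (add_le_add h1 h2)
  have hsubR' : ∀ᵐ w : Obs 𝒳 𝒵 ∂F₀, |α₀ w.z - α w.z| ≤ R + R₀ := by
    filter_upwards [hsubR] with w h; rwa [abs_sub_comm]
  have i1 : Integrable (fun w : Obs 𝒳 𝒵 => α w.z * ((γ - γ₀ : Γ) : 𝒳 → ℝ) w.x) F₀ :=
    hdiff.bdd_mul hαm hαR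
  have i1' : Integrable (fun w : Obs 𝒳 𝒵 => α₀ w.z * ((γ - γ₀ : Γ) : 𝒳 → ℝ) w.x) F₀ :=
    hdiff.bdd_mul hα₀m hα₀R
  have i2 : Integrable (fun w : Obs 𝒳 𝒵 => (α w.z - α₀ w.z) * (w.y - (γ₀ : 𝒳 → ℝ) w.x)) F₀ :=
    herr.bdd_mul (hαm.sub hα₀m) hsubR
  have i3 : Integrable (fun w => m w γ - m w γ₀) F₀ := (h_riesz γ).1.sub (h_riesz γ₀).1
  have hαα₀ : Measurable fun z => α z - α₀ z := hα.sub hα₀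
  have hα₀α : Measurable fun z => α₀ z - α z := hα₀.sub hα
  have i4 : Integrable (fun w : Obs 𝒳 𝒵 =>
      m w γ - m w γ₀ - α w.z * ((γ - γ₀ : Γ) : 𝒳 → ℝ) w.x) F₀ := i3.sub i1
  have e2 : ∫ w : Obs 𝒳 𝒵, (α w.z - α₀ w.z) * (w.y - (γ₀ : 𝒳 → ℝ) w.x) ∂F₀ = 0 := by
    rw [integral_mul_condExp_sigmaZ hαα₀ hsubR herr]
    refine integral_eq_zero_of_ae ?_
    filter_upwards [h_exog] with w hw
    simp [hw]
  have e3 : ∫ w, (m w γ - m w γ₀) ∂F₀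
      = ∫ w : Obs 𝒳 𝒵, α₀ w.z * ((γ - γ₀ : Γ) : 𝒳 → ℝ) w.x ∂F₀ := by
    rw [← (h_riesz (γ - γ₀)).2]
    simp only [map_sub]
  have key : ∫ w, (psi m 0 γ α w - psi m 0 γ₀ α₀ w) ∂F₀
      = ∫ w : Obs 𝒳 𝒵, (α₀ w.z - α w.z) * ((γ - γ₀ : Γ) : 𝒳 → ℝ) w.x ∂F₀ := by
    simp only [psi_sub_psi]
    rw [integral_add i4 i2, integral_sub i3 i1, e2, e3, add_zero, ← integral_sub i1' i1]
    simp only [sub_mul]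
  rw [key, integral_mul_condExp_sigmaZ hα₀α hsubR' hdiff]
  exact ofReal_abs_integral_mul_le (hα₀m.sub hαm) integrable_condExp.1

/-- The mean square error of the moment function is controlled by those of its ingredients. -/
lemma lintegral_psi_sub_sq_le
    (hΓ : ∀ γ ∈ Γ, Measurable γ ∧ MemLp (fun w : Obs 𝒳 𝒵 => γ w.x) 2 F₀)
    (hm_meas : ∀ γ : Γ, Measurable fun w => m w γ)
    (h_err : MemLp (fun w : Obs 𝒳 𝒵 => w.y - (γ₀ : 𝒳 → ℝ) w.x) 2 F₀) {C : ℝ}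
    (h_condvar : F₀[fun w : Obs 𝒳 𝒵 => (w.y - (γ₀ : 𝒳 → ℝ) w.x) ^ 2 | sigmaZ 𝒳 𝒵]
      ≤ᵐ[F₀] fun _ => C)
    (hα₀ : Measurable α₀) {R₀ : ℝ} (hα₀R : ∀ᵐ w ∂F₀, |α₀ w.z| ≤ R₀)
    (hα : Measurable α) {R : ℝ} (hαR : ∀ᵐ w ∂F₀, |α w.z| ≤ R) :
    ∫⁻ w, ENNReal.ofReal ((psi m 0 γ α w - psi m 0 γ₀ α₀ w) ^ 2) ∂F₀
      ≤ 3 * (∫⁻ w, ENNReal.ofReal ((m w γ - m w γ₀) ^ 2) ∂F₀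
        + ENNReal.ofReal (R ^ 2) * normX F₀ (γ - γ₀ : Γ) ^ 2
        + ENNReal.ofReal C * normZ F₀ (fun z => α₀ z - α z) ^ 2) := by
  have hsubR : ∀ᵐ w : Obs 𝒳 𝒵 ∂F₀, |α₀ w.z - α w.z| ≤ R₀ + R := by
    filter_upwards [hαR, hα₀R] with w h1 h2
    exact (abs_sub _ _).trans (add_le_add h2 h1)
  have hα₀α : Measurable fun z => α₀ z - α z := hα₀.sub hα
  have h3 := lintegral_mul_sq_le_of_condExp_sq_le hα₀α hsubR h_err h_condvar
  have h2 : ∫⁻ w : Obs 𝒳 𝒵, ENNReal.ofReal ((R * ((γ - γ₀ : Γ) : 𝒳 → ℝ) w.x) ^ 2) ∂F₀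
      = ENNReal.ofReal (R ^ 2) * normX F₀ (γ - γ₀ : Γ) ^ 2 := by
    rw [normX, eLpNorm_two_sq, ← lintegral_const_mul]
    · refine lintegral_congr fun w => ?_
      rw [mul_pow, ENNReal.ofReal_mul (sq_nonneg _)]
    · exact (((hΓ _ (γ - γ₀).2).1.comp measurable_obs_x).pow_const 2).ennreal_ofReal
  have mm : Measurable fun w : Obs 𝒳 𝒵 => ENNReal.ofReal ((m w γ - m w γ₀) ^ 2) :=
    (((hm_meas γ).sub (hm_meas γ₀)).pow_const 2).ennreal_ofReal
  have mx : Measurable fun w : Obs 𝒳 𝒵 =>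
      ENNReal.ofReal ((R * ((γ - γ₀ : Γ) : 𝒳 → ℝ) w.x) ^ 2) :=
    ((((hΓ _ (γ - γ₀).2).1.comp measurable_obs_x).const_mul R).pow_const 2).ennreal_ofReal
  have mmx : Measurable fun w : Obs 𝒳 𝒵 => ENNReal.ofReal ((m w γ - m w γ₀) ^ 2)
      + ENNReal.ofReal ((R * ((γ - γ₀ : Γ) : 𝒳 → ℝ) w.x) ^ 2) := mm.add mx
  rw [← h2]
  refine le_trans ?_ (mul_le_mul_right (add_le_add_right h3 _) 3)
  rw [← lintegral_add_left mm, ← lintegral_add_left mmx,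
    ← lintegral_const_mul' _ _ (by simp)]
  refine lintegral_mono_ae ?_
  filter_upwards [hαR] with w hw
  rw [psi_sub_psi, ← ENNReal.ofReal_add (sq_nonneg _) (sq_nonneg _),
    ← ENNReal.ofReal_add (by positivity) (sq_nonneg _),
    show (3 : ℝ≥0∞) = ENNReal.ofReal 3 by simp, ← ENNReal.ofReal_mul (by norm_num)]
  refine ENNReal.ofReal_le_ofReal ?_
  have hle : (α w.z * ((γ - γ₀ : Γ) : 𝒳 → ℝ) w.x) ^ 2 ≤ (R * ((γ - γ₀ : Γ) : 𝒳 → ℝ) w.x) ^ 2 := by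
    rw [mul_pow, mul_pow]
    refine mul_le_mul_of_nonneg_right ?_ (sq_nonneg _)
    rw [← sq_abs]; gcongr
  have hsq : ∀ x y z : ℝ, (x - y + z) ^ 2 ≤ 3 * (x ^ 2 + y ^ 2 + z ^ 2) := fun x y z => by
    nlinarith [sq_nonneg (x + y), sq_nonneg (x - z), sq_nonneg (y + z)]
  refine (hsq _ _ _).trans ?_
  have e : ((α w.z - α₀ w.z) * (w.y - (γ₀ : 𝒳 → ℝ) w.x)) ^ 2
      = ((α₀ w.z - α w.z) * (w.y - (γ₀ : 𝒳 → ℝ) w.x)) ^ 2 := by ring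
  rw [e]
  linarith

lemma memLp_psi (h_err : MemLp (fun w : Obs 𝒳 𝒵 => w.y - (γ₀ : 𝒳 → ℝ) w.x) 2 F₀)
    (h_m_sq : MemLp (fun w => m w γ₀) 2 F₀) (hα₀ : Measurable α₀) {R₀ : ℝ}
    (hα₀R : ∀ᵐ w ∂F₀, |α₀ w.z| ≤ R₀) (θ : ℝ) : MemLp (psi m θ γ₀ α₀) 2 F₀ :=
  (h_m_sq.sub (memLp_const θ)).add (h_err.mul (memLp_top_comp_z hα₀ hα₀R))

lemma integral_psi
    (h_exog : F₀[fun w : Obs 𝒳 𝒵 => w.y - (γ₀ : 𝒳 → ℝ) w.x | sigmaZ 𝒳 𝒵] =ᵐ[F₀] 0)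
    (h_err : MemLp (fun w : Obs 𝒳 𝒵 => w.y - (γ₀ : 𝒳 → ℝ) w.x) 2 F₀)
    (hm : Integrable (fun w => m w γ₀) F₀) (hα₀ : Measurable α₀) {R₀ : ℝ}
    (hα₀R : ∀ᵐ w ∂F₀, |α₀ w.z| ≤ R₀) (θ : ℝ) :
    ∫ w, psi m θ γ₀ α₀ w ∂F₀ = ∫ w, m w γ₀ ∂F₀ - θ := by
  have herr := h_err.integrable one_le_two
  have i2 : Integrable (fun w : Obs 𝒳 𝒵 => α₀ w.z * (w.y - (γ₀ : 𝒳 → ℝ) w.x)) F₀ :=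
    herr.bdd_mul (hα₀.comp measurable_obs_z).aestronglyMeasurable hα₀R
  have e2 : ∫ w : Obs 𝒳 𝒵, α₀ w.z * (w.y - (γ₀ : 𝒳 → ℝ) w.x) ∂F₀ = 0 := by
    rw [integral_mul_condExp_sigmaZ hα₀ hα₀R herr]
    refine integral_eq_zero_of_ae ?_
    filter_upwards [h_exog] with w hw
    simp [hw]
  have i1 : Integrable (fun w => m w γ₀ - θ) F₀ := hm.sub (integrable_const θ)
  simp only [psi]
  rw [integral_add i1 i2, e2, integral_sub hm (integrable_const θ)]
  simp

variable {p q : ℕ} {b : Fin p → 𝒵 → ℝ} {d : Fin q → Γ}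

lemma measurable_linComb (hb : ∀ k, Measurable (b k)) (ρ : Fin p → ℝ) :
    Measurable (linComb b ρ) :=
  Finset.measurable_sum _ fun k _ => (hb k).mul_const _

lemma abs_popG_le {d' : Fin q → 𝒳 → ℝ} {B : ℝ}
    (hdb : ∀ᵐ w ∂F₀, ∀ j k, |d' j w.x * b k w.z| ≤ B) (j : Fin q) (k : Fin p) :
    |popG F₀ d' b j k| ≤ B := by
  have h := norm_integral_le_of_norm_le_const (μ := F₀) (C := B)
    (f := fun w : Obs 𝒳 𝒵 => d' j w.x * b k w.z)
    (by filter_upwards [hdb] with w hw using hw j k)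
  simpa [popG] using h

/-- The population moment equations at `ρ` fail by at most the mean square distance of `b'ρ` from
the Riesz representer. -/
lemma ofReal_abs_popM_sub_le
    (hΓ : ∀ γ ∈ Γ, Measurable γ ∧ MemLp (fun w : Obs 𝒳 𝒵 => γ w.x) 2 F₀)
    (h_riesz : ∀ γ : Γ, Integrable (fun w => m w γ) F₀ ∧
      ∫ w, m w γ ∂F₀ = ∫ w : Obs 𝒳 𝒵, α₀ w.z * (γ : 𝒳 → ℝ) w.x ∂F₀)
    (hα₀ : Measurable α₀) {R₀ : ℝ} (hα₀R : ∀ᵐ w ∂F₀, |α₀ w.z| ≤ R₀)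
    (hb : ∀ k, Measurable (b k)) {Cb Cd : ℝ} (hbd : ∀ᵐ w : Obs 𝒳 𝒵 ∂F₀,
      (∀ k, |b k w.z| ≤ Cb) ∧ ∀ j, |(d j : 𝒳 → ℝ) w.x| ≤ Cd) (ρ : Fin p → ℝ) (j : Fin q) :
    ENNReal.ofReal |(popM F₀ m d - popG F₀ (fun j => (d j : 𝒳 → ℝ)) b *ᵥ ρ) j|
      ≤ normZ F₀ (fun z => α₀ z - linComb b ρ z) * ENNReal.ofReal Cd := by
  have hdm : AEStronglyMeasurable (fun w : Obs 𝒳 𝒵 => (d j : 𝒳 → ℝ) w.x) F₀ :=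
    (hΓ _ (d j).2).2.1
  have hdint : Integrable (fun w : Obs 𝒳 𝒵 => (d j : 𝒳 → ℝ) w.x) F₀ :=
    (hΓ _ (d j).2).2.integrable one_le_two
  have i0 : Integrable (fun w : Obs 𝒳 𝒵 => α₀ w.z * (d j : 𝒳 → ℝ) w.x) F₀ :=
    hdint.bdd_mul (hα₀.comp measurable_obs_z).aestronglyMeasurable hα₀R
  have ik : ∀ k, Integrable (fun w : Obs 𝒳 𝒵 => (d j : 𝒳 → ℝ) w.x * b k w.z) F₀ := fun k => by
    simp only [mul_comm ((d j : 𝒳 → ℝ) _)]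
    refine hdint.bdd_mul (c := Cb) ((hb k).comp measurable_obs_z).aestronglyMeasurable ?_
    filter_upwards [hbd] with w hw using hw.1 k
  have eG : (popG F₀ (fun j => (d j : 𝒳 → ℝ)) b *ᵥ ρ) j
      = ∫ w : Obs 𝒳 𝒵, linComb b ρ w.z * (d j : 𝒳 → ℝ) w.x ∂F₀ := by
    have : ∀ w : Obs 𝒳 𝒵, linComb b ρ w.z * (d j : 𝒳 → ℝ) w.x
        = ∑ k, (d j : 𝒳 → ℝ) w.x * b k w.z * ρ k := fun w => by
      rw [linComb, Finset.sum_mul]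
      exact Finset.sum_congr rfl fun k _ => by ring
    simp only [this]
    rw [integral_finsetSum _ fun k _ => (ik k).mul_const _]
    simp only [integral_mul_const]
    rfl
  have il : Integrable (fun w : Obs 𝒳 𝒵 => linComb b ρ w.z * (d j : 𝒳 → ℝ) w.x) F₀ := by
    refine hdint.bdd_mul (c := Cb * ∑ k, |ρ k|)
      ((measurable_linComb hb ρ).comp measurable_obs_z).aestronglyMeasurable ?_
    filter_upwards [hbd] with w hw using abs_linComb_le hw.1 ρ
  have key : (popM F₀ m d - popG F₀ (fun j => (d j : 𝒳 → ℝ)) b *ᵥ ρ) j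
      = ∫ w : Obs 𝒳 𝒵, (α₀ w.z - linComb b ρ w.z) * (d j : 𝒳 → ℝ) w.x ∂F₀ := by
    rw [Pi.sub_apply, eG, popM, (h_riesz (d j)).2, ← integral_sub i0 il]
    simp only [sub_mul]
  rw [key]
  refine (ofReal_abs_integral_mul_le
    ((hα₀.sub (measurable_linComb hb ρ)).comp measurable_obs_z).aestronglyMeasurable hdm).trans ?_
  refine mul_le_mul_right ?_ _
  have h := eLpNorm_le_of_ae_bound (μ := F₀) (p := 2) (C := Cd)
    (f := fun w : Obs 𝒳 𝒵 => (d j : 𝒳 → ℝ) w.x)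
    (by filter_upwards [hbd] with w hw using hw.2 j)
  simpa using h

lemma normZ_sub_linComb_le (hα₀ : Measurable α₀) (hb : ∀ k, Measurable (b k)) {Cb : ℝ}
    (hbd : ∀ᵐ w : Obs 𝒳 𝒵 ∂F₀, ∀ k, |b k w.z| ≤ Cb) (ρ ρ' : Fin p → ℝ) :
    normZ F₀ (fun z => α₀ z - linComb b ρ z)
      ≤ normZ F₀ (fun z => α₀ z - linComb b ρ' z)
        + ENNReal.ofReal (Cb * ∑ k, |ρ k - ρ' k|) := by
  have e : (fun w : Obs 𝒳 𝒵 => α₀ w.z - linComb b ρ w.z)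
      = (fun w : Obs 𝒳 𝒵 => α₀ w.z - linComb b ρ' w.z)
        - fun w : Obs 𝒳 𝒵 => linComb b (ρ - ρ') w.z := by
    ext w
    simp only [Pi.sub_apply, linComb, mul_sub, Finset.sum_sub_distrib]
    ring
  rw [normZ, e]
  refine (eLpNorm_sub_le
    ((hα₀.sub (measurable_linComb hb ρ')).comp measurable_obs_z).aestronglyMeasurable
    ((measurable_linComb hb _).comp measurable_obs_z).aestronglyMeasurable one_le_two).trans ?_
  refine add_le_add_right ?_ _
  have h := eLpNorm_le_of_ae_bound (μ := F₀) (p := 2) (C := Cb * ∑ k, |ρ k - ρ' k|)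
    (f := fun w : Obs 𝒳 𝒵 => linComb b (ρ - ρ') w.z)
    (by filter_upwards [hbd] with w hw using abs_linComb_le hw _)
  simpa [Function.comp_def] using h

end population

/-! ### The rate of the penalized GMM estimator of the Riesz representer -/

section rieszRate

lemma abs_sampleG_le {𝒳 𝒵 ι : Type*} [Fintype ι] {p q : ℕ} {d : Fin q → 𝒳 → ℝ} {b : Fin p → 𝒵 → ℝ}
    {s : ι → Obs 𝒳 𝒵} {B : ℝ} (hB : 0 ≤ B) (h : ∀ i j k, |d j (s i).x * b k (s i).z| ≤ B)
    (j : Fin q) (k : Fin p) : |sampleG d b s j k| ≤ B := by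
  rcases isEmpty_or_nonempty ι with hι | hι
  · simpa [sampleG] using hB
  have hN : (0 : ℝ) < Fintype.card ι := by exact_mod_cast Fintype.card_pos
  have h1 : |∑ i, d j (s i).x * b k (s i).z| ≤ Fintype.card ι * B := by
    refine (Finset.abs_sum_le_sum_abs _ _).trans ?_
    refine (Finset.sum_le_sum fun i _ => h i j k).trans (le_of_eq ?_)
    simp
  simp only [sampleG, Matrix.of_apply]
  rw [abs_mul, abs_of_pos (inv_pos.2 hN), inv_mul_le_iff₀ hN]
  exact h1

variable {Ω : Type*} [MeasurableSpace Ω] {P : Measure Ω}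
  {𝒳 𝒵 : Type*} [MeasurableSpace 𝒳] [MeasurableSpace 𝒵] {F₀ : Measure (Obs 𝒳 𝒵)}

/-- `X = O_p(ε)` and `ε = o(λ)` put a nonnegative `X` below any multiple of `λ`. -/
lemma IsBigOInProb.eventually_whp_le_mul {X : ℕ → Ω → ℝ≥0∞} {a lam : ℕ → ℝ}
    (h : IsBigOInProb P X a) (hlam : ∀ n, 0 < lam n) (ha : a =o[atTop] lam) {η : ℝ}
    (hη : 0 < η) : ∀ᶠ x in whp P, X x.1 x.2 ≤ ENNReal.ofReal (η * lam x.1) := by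
  have hr : Tendsto (fun n => (lam n)⁻¹ * a n) atTop (𝓝 0) := by
    refine ha.tendsto_div_nhds_zero.congr fun n => ?_
    rw [div_eq_inv_mul]
  filter_upwards [h.eventually_whp (fun n => (inv_pos.2 (hlam n)).le) hr hη] with x hx
  have hpos := hlam x.1
  calc X x.1 x.2
      = ENNReal.ofReal (lam x.1) * (ENNReal.ofReal (lam x.1)⁻¹ * X x.1 x.2) := by
        rw [← mul_assoc, ← ENNReal.ofReal_mul hpos.le, mul_inv_cancel₀ hpos.ne',
          ENNReal.ofReal_one, one_mul]
    _ ≤ ENNReal.ofReal (lam x.1) * ENNReal.ofReal η := by gcongr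
    _ = ENNReal.ofReal (η * lam x.1) := by rw [← ENNReal.ofReal_mul hpos.le, mul_comm]

/-- The approximation condition in unsquared form. For `C < 0` it forces the norm to vanish. -/
lemma normZ_le_of_sq_le {a : 𝒵 → ℝ} {C ε : ℝ} {s : ℕ} (hε : 0 ≤ ε)
    (h : normZ F₀ a ^ 2 ≤ ENNReal.ofReal (C * s * ε ^ 2)) :
    normZ F₀ a ≤ ENNReal.ofReal (√C * √s * ε) := by
  rw [← ENNReal.pow_le_pow_left_iff two_ne_zero]
  refine h.trans ?_
  rw [← ENNReal.ofReal_pow (by positivity)]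
  refine ENNReal.ofReal_le_ofReal ?_
  rw [mul_pow, mul_pow, Real.sq_sqrt (Nat.cast_nonneg s)]
  gcongr
  rcases le_total 0 C with hC | hC
  · rw [Real.sq_sqrt hC]
  · exact hC.trans (sq_nonneg _)

variable [IsProbabilityMeasure P] [IsProbabilityMeasure F₀]

lemma exists_pos_mul_le_one (x y z : ℝ) (hx : 0 ≤ x) (hy : 0 ≤ y) (hz : 0 ≤ z) :
    ∃ η : ℝ, 0 < η ∧ η ≤ 1 ∧ x * η ≤ 1 ∧ y * η ≤ 1 ∧ z * η ≤ 1 := by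
  have hpos : 0 < 1 + x + y + z := by positivity
  refine ⟨(1 + x + y + z)⁻¹, inv_pos.2 hpos, inv_le_one_of_one_le₀ (by linarith), ?_, ?_, ?_⟩
  all_goals
    rw [mul_inv_le_iff₀ hpos]
    linarith

variable {Γ : Submodule ℝ (𝒳 → ℝ)} {m : Obs 𝒳 𝒵 → Γ →ₗ[ℝ] ℝ} {α₀ : 𝒵 → ℝ}

/-- The penalized GMM estimator of the Riesz representer has root mean square error `O_p(s̄ λ)`, and
its coefficients are bounded in `ℓ₁`. When `s̄ = 0` neither `λ` nor `log q / n` need be small; then the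
representer vanishes and so does its estimator. -/
lemma exists_eventually_whp_normZ_sub_le
    (hΓ : ∀ γ ∈ Γ, Measurable γ ∧ MemLp (fun w : Obs 𝒳 𝒵 => γ w.x) 2 F₀)
    (hα₀ : Measurable α₀) {R₀ : ℝ} (hα₀R : ∀ᵐ w : Obs 𝒳 𝒵 ∂F₀, |α₀ w.z| ≤ R₀)
    (h_riesz : ∀ γ : Γ, Integrable (fun w => m w γ) F₀ ∧
      ∫ w, m w γ ∂F₀ = ∫ w : Obs 𝒳 𝒵, α₀ w.z * (γ : 𝒳 → ℝ) w.x ∂F₀)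
    {p q : ℕ → ℕ} (hpq : ∀ n, p n ≤ q n) (hq : ∀ n, 2 ≤ q n)
    {b : (n : ℕ) → Fin (p n) → 𝒵 → ℝ} (hb : ∀ n k, Measurable (b n k))
    {d : (n : ℕ) → Fin (q n) → Γ}
    {ι : ℕ → Type*} [∀ n, Fintype (ι n)]
    {U : (n : ℕ) → ι n → Ω → Obs 𝒳 𝒵} (hU : ∀ n i, Measurable (U n i))
    (hlaw : ∀ n i, P.map (U n i) = F₀) (hind : ∀ n, iIndepFun (U n) P)
    (hcard : ∀ᶠ n : ℕ in atTop, (n : ℝ) / 4 ≤ Fintype.card (ι n))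
    {Omh : (n : ℕ) → Ω → Matrix (Fin (q n)) (Fin (q n)) ℝ} (hOmh : ∀ n ω, (Omh n ω).PosSemidef)
    {lam : ℕ → ℝ} (hlam : ∀ n, 0 < lam n) {ρh : (n : ℕ) → Ω → Fin (p n) → ℝ}
    (hρh : ∀ n ω, IsMinOn (pgmmObjective (sampleM m (d n) fun i => U n i ω)
      (sampleG (fun j => (d n j : 𝒳 → ℝ)) (b n) fun i => U n i ω) (Omh n ω) (lam n))
      Set.univ (ρh n ω))
    {Om : (n : ℕ) → Matrix (Fin (q n)) (Fin (q n)) ℝ}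
    (h_weight_rate : IsBigOInProb P
      (fun n ω => ENNReal.ofReal (rowSumNorm (Omh n ω - Om n))) (epsG q))
    {COm : ℝ} (h_weight_bdd : ∀ᶠ n in atTop, rowSumNorm (Om n) ≤ COm) {Cb Cd : ℝ}
    (h_dict : ∀ᶠ n in atTop, ∀ᵐ w : Obs 𝒳 𝒵 ∂F₀,
      (∀ k, |b n k w.z| ≤ Cb) ∧ ∀ j, |(d n j : 𝒳 → ℝ) w.x| ≤ Cd)
    {εM : ℕ → ℝ} (h_M_rate : IsBigOInProb P
      (fun n ω => ‖(sampleM m (d n) fun i => U n i ω) - popM F₀ m (d n)‖ₑ) εM)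
    (hεM : Tendsto εM atTop (𝓝 0))
    {sbar : ℕ → ℕ} {ρbar : (n : ℕ) → Fin (p n) → ℝ}
    (h_sparse : ∀ n, (Finset.univ.filter fun k => ρbar n k ≠ 0).card ≤ sbar n) {C : ℝ}
    (h_approx : ∀ᶠ n in atTop, normZ F₀ (fun z => α₀ z - linComb (b n) (ρbar n) z) ^ 2
      ≤ ENNReal.ofReal (C * sbar n * epsMax q εM n ^ 2)) {A : ℝ}
    (h_ρbar_l1 : ∀ᶠ n in atTop, ∑ k, |ρbar n k| ≤ A) {c : ℝ} (hc : 0 < c)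
    (h_RE : ∀ᶠ n in atTop, RestrictedEigenvalueGE
      (gramG (popG F₀ (fun j => (d n j : 𝒳 → ℝ)) (b n)) (Om n)) (sbar n) c)
    (h_lam : epsMax q εM =o[atTop] lam)
    (h_slam : Tendsto (fun n => (sbar n : ℝ) * lam n) atTop (𝓝 0)) :
    ∃ K R : ℝ, 0 ≤ K ∧ 0 ≤ R ∧ ∀ᶠ x in whp P,
      normZ F₀ (fun z => α₀ z - linComb (b x.1) (ρh x.1 x.2) z)
        ≤ ENNReal.ofReal (K * (sbar x.1 * lam x.1)) ∧ ∑ k, |ρh x.1 x.2 k| ≤ R := by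
  set B : ℝ := |Cb| * |Cd| + 1 with hB_def
  have hB : 0 < B := by positivity
  set C' : ℝ := |COm| + 1 with hC'_def
  have hC' : 1 ≤ C' := by have := abs_nonneg COm; linarith
  set A' : ℝ := |A| with hA'_def
  have hA' : 0 ≤ A' := abs_nonneg A
  -- `η` is the tolerance of the deterministic bound, in units of `λ`.
  obtain ⟨η, hη0, hη1, hηx, hηy, hηz⟩ := exists_pos_mul_le_one (8 * B * C' * (1 + A')) (2 * C')
    ((2 * B * C' + B ^ 2) * (4 * A' + 1)) (by positivity) (by positivity) (by positivity)
  have hDb : ∀ᶠ n in atTop, ∀ᵐ w : Obs 𝒳 𝒵 ∂F₀,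
      ∀ j k, |(d n j : 𝒳 → ℝ) w.x * b n k w.z| ≤ B := by
    filter_upwards [h_dict] with n hn
    filter_upwards [hn] with w hw j k
    rw [abs_mul]
    calc |(d n j : 𝒳 → ℝ) w.x| * |b n k w.z| ≤ |Cd| * |Cb| :=
          mul_le_mul ((hw.2 j).trans (le_abs_self _)) ((hw.1 k).trans (le_abs_self _))
            (abs_nonneg _) (abs_nonneg _)
      _ ≤ B := by rw [hB_def]; linarith
  have hepsG : epsG q =o[atTop] lam := by
    refine IsBigO.trans_isLittleO (isBigO_of_le _ fun n => ?_) h_lam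
    rw [Real.norm_of_nonneg (epsG_nonneg q n), Real.norm_of_nonneg (epsMax_nonneg q εM n)]
    exact epsG_le_epsMax q εM n
  have hsmall : ∀ k : ℝ, 0 < k → ∀ᶠ n in atTop, epsMax q εM n ≤ k * lam n := fun k hk => by
    filter_upwards [h_lam.bound hk] with n hn
    rwa [Real.norm_of_nonneg (epsMax_nonneg q εM n), Real.norm_of_nonneg (hlam n).le] at hn
  have evG := eventually_whp_sampleG_sub_popG_le (d := fun n j => (d n j : 𝒳 → ℝ)) hU hlaw hind
    hcard hpq hq (fun n j => (hΓ _ (d n j).2).1) hb hB hDb hlam hepsG hη0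
  have evOm := h_weight_rate.eventually_whp_le_mul hlam hepsG hη0
  have evM := (h_M_rate.mono fun n => le_max_right (epsG q n) (εM n)).eventually_whp_le_mul
    hlam h_lam hη0
  have evM1 := h_M_rate.eventually_whp (r := fun _ => 1) (fun _ => zero_le_one)
    (by simpa using hεM) one_pos
  have evGh : ∀ᶠ x in whp P, ∀ j k,
      |sampleG (fun j => (d x.1 j : 𝒳 → ℝ)) (b x.1) (fun i => U x.1 i x.2) j k| ≤ B := by
    refine eventually_whp_of_ae ?_
    filter_upwards [hDb] with n hn
    have hall : ∀ᵐ ω ∂P, ∀ i, ∀ j k,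
        |(d n j : 𝒳 → ℝ) (U n i ω).x * b n k (U n i ω).z| ≤ B := by
      refine ae_all_iff.2 fun i => ?_
      rw [← hlaw n i] at hn
      exact ae_of_ae_map (hU n i).aemeasurable hn
    filter_upwards [hall] with ω hω
    exact abs_sampleG_le hB.le hω
  refine ⟨1 + |Cb| * (4 + 32 / c), A' + (4 + 32 / c), by positivity, by positivity, ?_⟩
  filter_upwards [evG, evOm, evM, evM1, evGh, eventually_whp_of_eventually h_weight_bdd,
    eventually_whp_of_eventually h_dict, eventually_whp_of_eventually hDb,
    eventually_whp_of_eventually h_approx, eventually_whp_of_eventually h_ρbar_l1,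
    eventually_whp_of_eventually h_RE,
    eventually_whp_of_eventually (hsmall (η / (√C * |Cd| + 1)) (by positivity)),
    eventually_whp_of_eventually (hsmall (1 / (√C + 1)) (by positivity)),
    eventually_whp_of_eventually (h_slam.eventually (gt_mem_nhds one_pos))] with
    ⟨n, ω⟩ xG xOm xM xM1 xGh xOmC xdict xDb xapp xl1 xRE xε xε' xslam
  dsimp only at *
  have hln := hlam n
  have hε0 := epsMax_nonneg q εM n
  have hs0 : (0 : ℝ) ≤ sbar n := Nat.cast_nonneg _
  have hOmd : rowSumNorm (Omh n ω - Om n) ≤ η * lam n :=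
    (ENNReal.ofReal_le_ofReal_iff (by positivity)).1 xOm
  have hMd : ∀ j, |sampleM m (d n) (fun i => U n i ω) j - popM F₀ m (d n) j| ≤ η * lam n ∧
      |sampleM m (d n) (fun i => U n i ω) j - popM F₀ m (d n) j| ≤ 1 := fun j => by
    have h0 := norm_le_pi_norm ((sampleM m (d n) fun i => U n i ω) - popM F₀ m (d n)) j
    simp only [ENNReal.ofReal_one, one_mul] at xM1
    rw [← ofReal_norm] at xM xM1
    rw [← ENNReal.ofReal_one] at xM1
    exact ⟨h0.trans ((ENNReal.ofReal_le_ofReal_iff (by positivity)).1 xM),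
      h0.trans ((ENNReal.ofReal_le_ofReal_iff zero_le_one).1 xM1)⟩
  have hnormZ := normZ_le_of_sq_le hε0 xapp
  have happ : ∀ j, |(popM F₀ m (d n) - popG F₀ (fun j => (d n j : 𝒳 → ℝ)) (b n) *ᵥ ρbar n) j|
      ≤ η * √(sbar n) * lam n := fun j => by
    have h1 := ofReal_abs_popM_sub_le hΓ h_riesz hα₀ hα₀R (hb n)
      (xdict.mono fun w hw => ⟨hw.1, fun j => (hw.2 j).trans (le_abs_self _)⟩) (ρbar n) j
    have h2 := h1.trans (mul_le_mul_left hnormZ _)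
    rw [← ENNReal.ofReal_mul (by positivity), ENNReal.ofReal_le_ofReal_iff (by positivity)] at h2
    refine h2.trans ?_
    have h3 : (√C * |Cd| + 1) * epsMax q εM n ≤ η * lam n := by
      have : 0 < √C * |Cd| + 1 := by positivity
      rw [div_mul_eq_mul_div, le_div_iff₀ this] at xε
      linarith
    calc √C * √(sbar n) * epsMax q εM n * |Cd|
        = √(sbar n) * (√C * |Cd| * epsMax q εM n) := by ring
      _ ≤ √(sbar n) * (η * lam n) :=
        mul_le_mul_of_nonneg_left (by linarith) (Real.sqrt_nonneg _)
      _ = η * √(sbar n) * lam n := by ring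
  have hOmhle : rowSumNorm (Omh n ω) ≤ η * lam n + |COm| :=
    (rowSumNorm_le_add _ (Om n)).trans (add_le_add hOmd (xOmC.trans (le_abs_self _)))
  have hl1 : ∑ k, |ρh n ω k - ρbar n k| ≤ (4 + 32 / c) * (sbar n * lam n) := by
    rcases Nat.eq_zero_or_pos (sbar n) with hs | hs
    · have hρ0 : ρbar n = 0 := by
        have h := h_sparse n
        rw [hs, Nat.le_zero, Finset.card_eq_zero, Finset.filter_eq_empty_iff] at h
        ext k
        simpa using h (Finset.mem_univ k)
      have hM0 : ∀ j, popM F₀ m (d n) j = 0 := fun j => by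
        have h := happ j
        rw [hρ0, hs, Matrix.mulVec_zero, sub_zero] at h
        simpa using h
      have hM : ∀ j, |sampleM m (d n) (fun i => U n i ω) j| ≤ min (η * lam n) 1 := fun j => by
        have h := hMd j
        rw [hM0 j, sub_zero] at h
        exact le_min h.1 h.2
      have hmin0 : 0 ≤ min (η * lam n) 1 := le_min (by positivity) zero_le_one
      have hBη : B * η ≤ 1 / 8 := by
        have h1 : B * η * 1 ≤ B * η * (C' * (1 + A')) := by
          have : 1 ≤ C' * (1 + A') := by nlinarith
          gcongr
        nlinarith
      have hBC : B * C' * η ≤ 1 / 8 := by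
        have h1 : B * C' * η * 1 ≤ B * C' * η * (1 + A') := by gcongr; linarith
        nlinarith
      have h0 := eq_zero_of_score_lt (hOmh n ω) (hρh n ω) hB.le hmin0 xGh hM (by
        calc rowSumNorm (Omh n ω) * B * min (η * lam n) 1
            ≤ (η * lam n + C') * B * min (η * lam n) 1 := by gcongr; linarith
          _ = (η * lam n * B) * min (η * lam n) 1 + C' * B * min (η * lam n) 1 := by ring
          _ ≤ (η * lam n * B) * 1 + C' * B * (η * lam n) := by
            gcongr
            · exact min_le_right _ _
            · exact min_le_left _ _
          _ = (B * η + B * C' * η) * lam n := by ring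
          _ ≤ (1 / 8 + 1 / 8) * lam n := by gcongr
          _ < lam n := by linarith)
      simp [hρ0, h0, hs]
    · have hlam1 : lam n ≤ 1 := by
        have h1 : (1 : ℝ) ≤ sbar n := by exact_mod_cast hs
        nlinarith
      refine l1_bound_of_isMinOn (hOmh n ω) (hρh n ω) (M := popM F₀ m (d n))
        (G := popG F₀ (fun j => (d n j : 𝒳 → ℝ)) (b n)) (Om := Om n) (B := B) (C := C') (A := A')
        (η := η) hc hln hB.le hη0.le xslam.le (h_sparse n) (xl1.trans (le_abs_self _)) xRE
        (abs_popG_le xDb) xGh ?_ ?_ xG hOmd (fun j => (hMd j).1) happ hηx ?_ hηz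
      · exact (xOmC.trans (le_abs_self _)).trans (by linarith)
      · refine hOmhle.trans ?_
        have : η * lam n ≤ 1 * 1 := by gcongr
        linarith
      · calc 2 * C' * η ^ 2 = (2 * C' * η) * η := by ring
          _ ≤ 1 * 1 := by gcongr
          _ = 1 := one_mul 1
  constructor
  · refine (normZ_sub_linComb_le hα₀ (hb n) (xdict.mono fun w hw k => hw.1 k) _ (ρbar n)).trans ?_
    refine (add_le_add_left hnormZ _).trans ?_
    have h1 : √C * √(sbar n) * epsMax q εM n ≤ sbar n * lam n := by
      have h2 : (√C + 1) * epsMax q εM n ≤ lam n := by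
        have : 0 < √C + 1 := by positivity
        rw [div_mul_eq_mul_div, le_div_iff₀ this] at xε'
        linarith
      -- `√s ≤ s` for natural numbers
      have h3 : √(sbar n : ℝ) ≤ sbar n := by
        rw [Real.sqrt_le_left hs0, sq]
        exact_mod_cast Nat.le_mul_self _
      calc √C * √(sbar n) * epsMax q εM n = √(sbar n) * (√C * epsMax q εM n) := by ring
        _ ≤ sbar n * lam n := by gcongr; linarith
    have h2 : Cb * ∑ k, |ρh n ω k - ρbar n k| ≤ |Cb| * ((4 + 32 / c) * (sbar n * lam n)) := by
      gcongr
      exact le_abs_self _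
    calc ENNReal.ofReal (√C * √(sbar n) * epsMax q εM n)
          + ENNReal.ofReal (Cb * ∑ k, |ρh n ω k - ρbar n k|)
        ≤ ENNReal.ofReal (sbar n * lam n)
          + ENNReal.ofReal (|Cb| * ((4 + 32 / c) * (sbar n * lam n))) := by gcongr
      _ = ENNReal.ofReal ((1 + |Cb| * (4 + 32 / c)) * (sbar n * lam n)) := by
        rw [← ENNReal.ofReal_add (by positivity) (by positivity)]; ring_nf
  · calc ∑ k, |ρh n ω k| ≤ ∑ k, |ρbar n k| + ∑ k, |ρh n ω k - ρbar n k| := by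
          rw [← Finset.sum_add_distrib]
          refine Finset.sum_le_sum fun k _ => ?_
          have := abs_add_le (ρbar n k) (ρh n ω k - ρbar n k)
          simpa using this
      _ ≤ A' + (4 + 32 / c) * 1 := by
          refine add_le_add (xl1.trans (le_abs_self _)) (hl1.trans ?_)
          gcongr
      _ = A' + (4 + 32 / c) := by ring

end rieszRate

/-! ### Errors of the moment function on a fold -/

section fold

variable {Ω : Type*} [MeasurableSpace Ω] {P : Measure Ω}

lemma TendstoZeroInProb.tendsto_whp {X : ℕ → Ω → ℝ≥0∞} (h : TendstoZeroInProb P X) :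
    Tendsto (fun x : ℕ × Ω => X x.1 x.2) (whp P) (𝓝 0) := by
  rw [ENNReal.tendsto_nhds_zero]
  intro ε hε
  rcases eq_or_ne ε ∞ with rfl | hε'
  · simp
  · filter_upwards [h.eventually_whp (ENNReal.toReal_pos hε.ne' hε')] with x hx
    rw [ENNReal.ofReal_toReal hε'] at hx
    exact hx.le

/-- A conditional bound that holds on events of probability tending to one. -/
lemma eventually_whp_of_measure_and_le {p : ℕ × Ω → Prop} {g : ℕ × Ω → ℝ≥0∞}
    (hg : Tendsto g (whp P) (𝓝 0))
    (h : ∀ δ : ℝ, 0 < δ → ∃ η : ℝ, 0 < η ∧ ∀ᶠ n in atTop,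
      P {ω | g (n, ω) ≤ ENNReal.ofReal η ∧ ¬ p (n, ω)} ≤ ENNReal.ofReal δ) :
    ∀ᶠ x in whp P, p x := by
  refine eventually_whp_of_le fun δ hδ => ?_
  obtain ⟨η, hη, hn⟩ := h (δ / 2) (half_pos hδ)
  have h1 := eventually_whp.1 ((ENNReal.tendsto_nhds_zero.1 hg) (ENNReal.ofReal η)
    (ENNReal.ofReal_pos.2 hη))
  have h2 := (ENNReal.tendsto_nhds_zero.1 h1) (ENNReal.ofReal (δ / 2))
    (ENNReal.ofReal_pos.2 (half_pos hδ))
  filter_upwards [hn, h2] with n hn h2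
  calc P {ω | ¬ p (n, ω)}
      ≤ P ({ω | g (n, ω) ≤ ENNReal.ofReal η ∧ ¬ p (n, ω)}
          ∪ {ω | ¬ g (n, ω) ≤ ENNReal.ofReal η}) := by
        refine measure_mono fun ω hω => ?_
        by_cases hgω : g (n, ω) ≤ ENNReal.ofReal η
        · exact Or.inl ⟨hgω, hω⟩
        · exact Or.inr hgω
    _ ≤ ENNReal.ofReal (δ / 2) + ENNReal.ofReal (δ / 2) :=
        (measure_union_le _ _).trans (add_le_add hn h2)
    _ = ENNReal.ofReal δ := by
        rw [← ENNReal.ofReal_add (half_pos hδ).le (half_pos hδ).le, add_halves]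

variable [IsProbabilityMeasure P] {𝒲 : Type*} [MeasurableSpace 𝒲] {F : Measure 𝒲}
  [IsProbabilityMeasure F]

/-- Stochastic equicontinuity from sample splitting: a function estimated on the other folds whose
mean square tends to zero in probability has negligible centred fold sums at the scale `√n`. -/
lemma tendsto_whp_sqrt_mul_fold_sum {τ ι : ℕ → Type*} [∀ n, MeasurableSpace (τ n)]
    [∀ n, Fintype (ι n)] {T : (n : ℕ) → Ω → τ n} {U : (n : ℕ) → ι n → Ω → 𝒲}
    (hT : ∀ n, Measurable (T n)) (hU : ∀ n i, Measurable (U n i))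
    (hlaw : ∀ n i, P.map (U n i) = F) (hind : ∀ n, iIndepFun (U n) P)
    (hTU : ∀ n, IndepFun (T n) (fun ω i => U n i ω) P) (hcard : ∀ n, Fintype.card (ι n) ≤ n)
    {f : (n : ℕ) → τ n → 𝒲 → ℝ} (hf : ∀ n, Measurable (Function.uncurry (f n)))
    (hsq : Tendsto (fun x : ℕ × Ω => ∫⁻ w, ENNReal.ofReal (f x.1 (T x.1 x.2) w ^ 2) ∂F)
      (whp P) (𝓝 0)) :
    Tendsto (fun x : ℕ × Ω => √(x.1 : ℝ) * ((x.1 : ℝ)⁻¹ *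
      ∑ i, (f x.1 (T x.1 x.2) (U x.1 i x.2) - ∫ w, f x.1 (T x.1 x.2) w ∂F))) (whp P) (𝓝 0) := by
  rw [Metric.tendsto_nhds]
  intro ε hε
  refine eventually_whp_of_measure_and_le hsq fun δ hδ => ⟨δ * ε ^ 2, by positivity, ?_⟩
  filter_upwards [eventually_gt_atTop 0] with n hn
  have hn' : (0 : ℝ) < n := by exact_mod_cast hn
  have hs : 0 < √(n : ℝ) := Real.sqrt_pos.2 hn'
  have h := measure_abs_sum_sub_integral_le (hT n) (hU n) (hlaw n) (hind n) (hTU n) (hf n)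
    (η := δ * ε ^ 2) (a := ε * √(n : ℝ)) (by positivity) (by positivity)
  refine le_trans (measure_mono ?_) (h.trans (ENNReal.ofReal_le_ofReal ?_))
  · intro ω hω
    refine ⟨hω.1, ?_⟩
    have h2 := hω.2
    rw [not_lt, Real.dist_eq, sub_zero, ← mul_assoc, abs_mul, abs_of_pos (by positivity)] at h2
    have e : √(n : ℝ) * (n : ℝ)⁻¹ = (√(n : ℝ))⁻¹ := by
      rw [← div_eq_mul_inv, Real.sqrt_div_self]
    rw [e, le_inv_mul_iff₀ hs] at h2
    linarith
  · rw [mul_pow, Real.sq_sqrt hn'.le, div_le_iff₀ (by positivity)]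
    have : (Fintype.card (ι n) : ℝ) ≤ n := by exact_mod_cast hcard n
    calc (Fintype.card (ι n) : ℝ) * (δ * ε ^ 2) ≤ n * (δ * ε ^ 2) := by gcongr
      _ = δ * (ε ^ 2 * n) := by ring

/-- The analogue for the squares needs no centring. -/
lemma tendsto_whp_fold_mean_sq {τ ι : ℕ → Type*} [∀ n, MeasurableSpace (τ n)]
    [∀ n, Fintype (ι n)] {T : (n : ℕ) → Ω → τ n} {U : (n : ℕ) → ι n → Ω → 𝒲}
    (hT : ∀ n, Measurable (T n)) (hU : ∀ n i, Measurable (U n i))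
    (hlaw : ∀ n i, P.map (U n i) = F)
    (hTU : ∀ n, IndepFun (T n) (fun ω i => U n i ω) P) (hcard : ∀ n, Fintype.card (ι n) ≤ n)
    {f : (n : ℕ) → τ n → 𝒲 → ℝ} (hf : ∀ n, Measurable (Function.uncurry (f n)))
    (hsq : Tendsto (fun x : ℕ × Ω => ∫⁻ w, ENNReal.ofReal (f x.1 (T x.1 x.2) w ^ 2) ∂F)
      (whp P) (𝓝 0)) :
    Tendsto (fun x : ℕ × Ω => (x.1 : ℝ)⁻¹ * ∑ i, f x.1 (T x.1 x.2) (U x.1 i x.2) ^ 2)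
      (whp P) (𝓝 0) := by
  rw [Metric.tendsto_nhds]
  intro ε hε
  refine eventually_whp_of_measure_and_le hsq fun δ hδ => ⟨δ * ε, by positivity, ?_⟩
  filter_upwards [eventually_gt_atTop 0] with n hn
  have hn' : (0 : ℝ) < n := by exact_mod_cast hn
  have h := measure_sum_sq_le (hT n) (hU n) (hlaw n) (hTU n) (hf n)
    (η := δ * ε) (a := ε * n) (by positivity)
  refine le_trans (measure_mono ?_) (h.trans (ENNReal.ofReal_le_ofReal ?_))
  · intro ω hω
    refine ⟨hω.1, ?_⟩
    have h2 := hω.2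
    have h0 : 0 ≤ ∑ i, f n (T n ω) (U n i ω) ^ 2 := Finset.sum_nonneg fun _ _ => sq_nonneg _
    rw [not_lt, Real.dist_eq, sub_zero, abs_of_nonneg (by positivity),
      le_inv_mul_iff₀ hn'] at h2
    linarith
  · rw [div_le_iff₀ (by positivity)]
    have : (Fintype.card (ι n) : ℝ) ≤ n := by exact_mod_cast hcard n
    calc (Fintype.card (ι n) : ℝ) * (δ * ε) ≤ n * (δ * ε) := by gcongr
      _ = δ * (ε * n) := by ring

end fold

section momentError

lemma ae_abs_linComb_le {𝒳 𝒵 : Type*} [MeasurableSpace 𝒳] [MeasurableSpace 𝒵]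
    {F₀ : Measure (Obs 𝒳 𝒵)} {p : ℕ} {b : Fin p → 𝒵 → ℝ} {ρ : Fin p → ℝ} {Cb R : ℝ}
    (hb : ∀ᵐ w : Obs 𝒳 𝒵 ∂F₀, ∀ k, |b k w.z| ≤ Cb) (hρ : ∑ k, |ρ k| ≤ R) :
    ∀ᵐ w : Obs 𝒳 𝒵 ∂F₀, |linComb b ρ w.z| ≤ |Cb| * R := by
  filter_upwards [hb] with w hw
  exact (abs_linComb_le (fun k => (hw k).trans (le_abs_self Cb)) ρ).trans (by gcongr)

variable {Ω : Type*} [MeasurableSpace Ω] {P : Measure Ω}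
  {𝒳 𝒵 : Type*} [MeasurableSpace 𝒳] [MeasurableSpace 𝒵]
  {F₀ : Measure (Obs 𝒳 𝒵)} [IsProbabilityMeasure F₀]
  {Γ : Submodule ℝ (𝒳 → ℝ)} {m : Obs 𝒳 𝒵 → Γ →ₗ[ℝ] ℝ} {γ₀ : Γ} {α₀ : 𝒵 → ℝ}
  {p : ℕ → ℕ} {b : (n : ℕ) → Fin (p n) → 𝒵 → ℝ}
  {γh : ℕ → Ω → Γ} {ρh : (n : ℕ) → Ω → Fin (p n) → ℝ} {r : ℕ → ℝ} {K R : ℝ}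

lemma tendsto_whp_lintegral_psi_sub_sq
    (hΓ : ∀ γ ∈ Γ, Measurable γ ∧ MemLp (fun w : Obs 𝒳 𝒵 => γ w.x) 2 F₀)
    (hm_meas : ∀ γ : Γ, Measurable fun w => m w γ)
    (h_err : MemLp (fun w : Obs 𝒳 𝒵 => w.y - (γ₀ : 𝒳 → ℝ) w.x) 2 F₀) {C : ℝ}
    (h_condvar : F₀[fun w : Obs 𝒳 𝒵 => (w.y - (γ₀ : 𝒳 → ℝ) w.x) ^ 2 | sigmaZ 𝒳 𝒵]
      ≤ᵐ[F₀] fun _ => C)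
    (hα₀ : Measurable α₀) {R₀ : ℝ} (hα₀R : ∀ᵐ w ∂F₀, |α₀ w.z| ≤ R₀)
    (hb : ∀ n k, Measurable (b n k)) {Cb : ℝ}
    (hbd : ∀ᶠ n in atTop, ∀ᵐ w : Obs 𝒳 𝒵 ∂F₀, ∀ k, |b n k w.z| ≤ Cb)
    (hrate : ∀ᶠ x in whp P,
      normZ F₀ (fun z => α₀ z - linComb (b x.1) (ρh x.1 x.2) z) ≤ ENNReal.ofReal (K * r x.1) ∧
      ∑ k, |ρh x.1 x.2 k| ≤ R)
    (hr : Tendsto r atTop (𝓝 0))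
    (h_m : TendstoZeroInProb P fun n ω =>
      ∫⁻ w, ENNReal.ofReal ((m w (γh n ω) - m w γ₀) ^ 2) ∂F₀)
    (h_γ : TendstoZeroInProb P fun n ω => normX F₀ (γh n ω - γ₀ : Γ)) :
    Tendsto (fun x : ℕ × Ω => ∫⁻ w, ENNReal.ofReal
      ((psi m 0 (γh x.1 x.2) (linComb (b x.1) (ρh x.1 x.2)) w - psi m 0 γ₀ α₀ w) ^ 2) ∂F₀)
      (whp P) (𝓝 0) := by
  have hZ : Tendsto (fun x : ℕ × Ω =>
      normZ F₀ (fun z => α₀ z - linComb (b x.1) (ρh x.1 x.2) z)) (whp P) (𝓝 0) := by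
    have h1 : Tendsto (fun x : ℕ × Ω => ENNReal.ofReal (K * r x.1)) (whp P) (𝓝 0) := by
      have := ENNReal.tendsto_ofReal ((hr.const_mul K).comp (tendsto_fst_whp (P := P)))
      simpa using this
    exact tendsto_of_tendsto_of_tendsto_of_le_of_le' tendsto_const_nhds h1
      (Eventually.of_forall fun _ => zero_le) (hrate.mono fun x hx => hx.1)
  have hlim : Tendsto (fun x : ℕ × Ω =>
      3 * (∫⁻ w, ENNReal.ofReal ((m w (γh x.1 x.2) - m w γ₀) ^ 2) ∂F₀
        + ENNReal.ofReal ((|Cb| * R) ^ 2) * normX F₀ (γh x.1 x.2 - γ₀ : Γ) ^ 2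
        + ENNReal.ofReal C * normZ F₀ (fun z => α₀ z - linComb (b x.1) (ρh x.1 x.2) z) ^ 2))
      (whp P) (𝓝 0) := by
    have h1 := ENNReal.Tendsto.const_mul (a := ENNReal.ofReal ((|Cb| * R) ^ 2))
      (ENNReal.Tendsto.pow (n := 2) h_γ.tendsto_whp) (Or.inr ENNReal.ofReal_ne_top)
    have h2 := ENNReal.Tendsto.const_mul (a := ENNReal.ofReal C)
      (ENNReal.Tendsto.pow (n := 2) hZ) (Or.inr ENNReal.ofReal_ne_top)
    have h3 := ENNReal.Tendsto.const_mul (a := 3) ((h_m.tendsto_whp.add h1).add h2)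
      (Or.inr (by simp))
    simpa using h3
  refine tendsto_of_tendsto_of_tendsto_of_le_of_le' tendsto_const_nhds hlim
    (Eventually.of_forall fun _ => zero_le) ?_
  filter_upwards [hrate, eventually_whp_of_eventually hbd] with x hx hbx
  exact lintegral_psi_sub_sq_le hΓ hm_meas h_err h_condvar hα₀ hα₀R (measurable_linComb (hb _) _)
    (ae_abs_linComb_le hbx hx.2)

/-- The conditional bias of the fold moments is of smaller order than `1 / √n`: it is at most the
product of the two rates. -/
lemma tendsto_whp_sqrt_mul_integral_psi_sub
    (hΓ : ∀ γ ∈ Γ, Measurable γ ∧ MemLp (fun w : Obs 𝒳 𝒵 => γ w.x) 2 F₀)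
    (h_exog : F₀[fun w : Obs 𝒳 𝒵 => w.y - (γ₀ : 𝒳 → ℝ) w.x | sigmaZ 𝒳 𝒵] =ᵐ[F₀] 0)
    (h_err : MemLp (fun w : Obs 𝒳 𝒵 => w.y - (γ₀ : 𝒳 → ℝ) w.x) 2 F₀)
    (h_riesz : ∀ γ : Γ, Integrable (fun w => m w γ) F₀ ∧
      ∫ w, m w γ ∂F₀ = ∫ w : Obs 𝒳 𝒵, α₀ w.z * (γ : 𝒳 → ℝ) w.x ∂F₀)
    (hα₀ : Measurable α₀) {R₀ : ℝ} (hα₀R : ∀ᵐ w ∂F₀, |α₀ w.z| ≤ R₀)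
    (hb : ∀ n k, Measurable (b n k)) {Cb : ℝ}
    (hbd : ∀ᶠ n in atTop, ∀ᵐ w : Obs 𝒳 𝒵 ∂F₀, ∀ k, |b n k w.z| ≤ Cb) (hK : 0 ≤ K)
    (hrate : ∀ᶠ x in whp P,
      normZ F₀ (fun z => α₀ z - linComb (b x.1) (ρh x.1 x.2) z) ≤ ENNReal.ofReal (K * r x.1) ∧
      ∑ k, |ρh x.1 x.2 k| ≤ R)
    (hr : ∀ n, 0 ≤ r n) {κγ : ℕ → ℝ}
    (h_proj : IsBigOInProb P (fun n ω => projNorm F₀ (γh n ω - γ₀ : Γ)) κγ)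
    (h_rates : Tendsto (fun n : ℕ => √(n : ℝ) * r n * κγ n) atTop (𝓝 0)) :
    Tendsto (fun x : ℕ × Ω => √(x.1 : ℝ) *
      ∫ w, (psi m 0 (γh x.1 x.2) (linComb (b x.1) (ρh x.1 x.2)) w - psi m 0 γ₀ α₀ w) ∂F₀)
      (whp P) (𝓝 0) := by
  rw [Metric.tendsto_nhds]
  intro ε hε
  have hlim : Tendsto (fun n : ℕ => (K * (√(n : ℝ) * r n)) * κγ n) atTop (𝓝 0) := by
    have := h_rates.const_mul K
    simpa [mul_assoc] using this
  have hpos : ∀ n : ℕ, 0 ≤ K * (√(n : ℝ) * r n) := fun n => by have := hr n; positivity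
  filter_upwards [hrate, eventually_whp_of_eventually hbd,
    h_proj.eventually_whp hpos hlim (half_pos hε)] with x hx hbx hproj
  have h1 := ofReal_abs_integral_psi_sub_le (γ := γh x.1 x.2) hΓ h_exog h_err h_riesz hα₀ hα₀R
    (measurable_linComb (hb _) (ρh x.1 x.2)) (ae_abs_linComb_le hbx hx.2)
  set I := ∫ w, (psi m 0 (γh x.1 x.2) (linComb (b x.1) (ρh x.1 x.2)) w - psi m 0 γ₀ α₀ w) ∂F₀
    with hI
  have hs : 0 ≤ √(x.1 : ℝ) := Real.sqrt_nonneg _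
  have h2 : ENNReal.ofReal (√(x.1 : ℝ) * |I|) ≤ ENNReal.ofReal (ε / 2) := by
    rw [ENNReal.ofReal_mul hs]
    calc ENNReal.ofReal (√(x.1 : ℝ)) * ENNReal.ofReal |I|
        ≤ ENNReal.ofReal (√(x.1 : ℝ)) * (ENNReal.ofReal (K * r x.1)
            * projNorm F₀ (γh x.1 x.2 - γ₀ : Γ)) := by
          gcongr
          exact h1.trans (mul_le_mul_left hx.1 _)
      _ = ENNReal.ofReal (K * (√(x.1 : ℝ) * r x.1)) * projNorm F₀ (γh x.1 x.2 - γ₀ : Γ) := by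
          rw [← mul_assoc, ← ENNReal.ofReal_mul hs]; ring_nf
      _ ≤ ENNReal.ofReal (ε / 2) := hproj
  have h3 := (ENNReal.ofReal_le_ofReal_iff (half_pos hε).le).1 h2
  rw [Real.dist_eq, sub_zero, abs_mul, abs_of_nonneg hs]
  linarith

end momentError

/-! ### Decomposition of the cross-fitted estimators -/

section decomposition

lemma sum_fold {n L : ℕ} (fold : Fin n → Fin L) (h : Fin L → Fin n → ℝ) :
    ∑ ℓ : Fin L, ∑ i : Fin n with fold i = ℓ, h ℓ i = ∑ i, h (fold i) i := by
  rw [← Finset.sum_fiberwise Finset.univ fold fun i => h (fold i) i]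
  refine Finset.sum_congr rfl fun ℓ _ => Finset.sum_congr rfl fun i hi => ?_
  rw [(Finset.mem_filter.1 hi).2]

lemma sum_fold_subtype {n L : ℕ} (fold : Fin n → Fin L) (h : Fin L → Fin n → ℝ) :
    ∑ ℓ : Fin L, ∑ i : {i : Fin n // fold i = ℓ}, h ℓ i = ∑ i, h (fold i) i := by
  rw [← sum_fold]
  exact Finset.sum_congr rfl fun ℓ _ => (Finset.sum_subtype _ (by simp) _).symm

variable {𝒳 𝒵 : Type*} {Γ : Submodule ℝ (𝒳 → ℝ)} {m : Obs 𝒳 𝒵 → Γ →ₗ[ℝ] ℝ} {γ₀ : Γ}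
  {α₀ : 𝒵 → ℝ} {n L p : ℕ} {b : Fin p → 𝒵 → ℝ} {fold : Fin n → Fin L}
  {γhat : (ℓ : Fin L) → Train 𝒳 𝒵 fold ℓ → Γ}
  {ρhat : (ℓ : Fin L) → Train 𝒳 𝒵 fold ℓ → Fin p → ℝ}

/-- The error of the estimated moment function for fold `ℓ`, given its training sample. The target
`θ` drops out of the difference and is set to zero. -/
def momentError (m : Obs 𝒳 𝒵 → Γ →ₗ[ℝ] ℝ) (γ₀ : Γ) (α₀ : 𝒵 → ℝ) (b : Fin p → 𝒵 → ℝ)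
    {ℓ : Fin L} (γhat : Train 𝒳 𝒵 fold ℓ → Γ) (ρhat : Train 𝒳 𝒵 fold ℓ → Fin p → ℝ)
    (t : Train 𝒳 𝒵 fold ℓ) (w : Obs 𝒳 𝒵) : ℝ :=
  psi m 0 (γhat t) (linComb b (ρhat t)) w - psi m 0 γ₀ α₀ w

lemma psi_eq_add_momentError (θ θ₀ : ℝ) {ℓ : Fin L} (t : Train 𝒳 𝒵 fold ℓ) (w : Obs 𝒳 𝒵) :
    psi m θ (γhat ℓ t) (linComb b (ρhat ℓ t)) w
      = psi m θ₀ γ₀ α₀ w + momentError m γ₀ α₀ b (γhat ℓ) (ρhat ℓ) t w - (θ - θ₀) := by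
  simp only [momentError, psi]; ring

/-- The estimation error is the oracle average, plus the centred fold sums of the moment errors,
plus their conditional biases `I ℓ`. -/
lemma sqrt_mul_thetaHat_sub (hn : 0 < n) (θ₀ : ℝ) (s : Fin n → Obs 𝒳 𝒵) (I : Fin L → ℝ) :
    √(n : ℝ) * (thetaHat m b fold γhat ρhat s - θ₀)
      = (√(n : ℝ))⁻¹ * ∑ i, psi m θ₀ γ₀ α₀ (s i)
        + ∑ ℓ, (√(n : ℝ) * ((n : ℝ)⁻¹ * ∑ i : {i : Fin n // fold i = ℓ},
            (momentError m γ₀ α₀ b (γhat ℓ) (ρhat ℓ) (leaveOut fold ℓ s) (s i) - I ℓ))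
          + ((Finset.univ.filter fun i : Fin n => fold i = ℓ).card : ℝ) / n
            * (√(n : ℝ) * I ℓ)) := by
  have hn' : (0 : ℝ) < n := by exact_mod_cast hn
  have hs : √(n : ℝ) * (n : ℝ)⁻¹ = (√(n : ℝ))⁻¹ := by
    rw [← div_eq_mul_inv, Real.sqrt_div_self]
  have h1 : thetaHat m b fold γhat ρhat s - θ₀ = (n : ℝ)⁻¹ * (∑ i, psi m θ₀ γ₀ α₀ (s i)
      + ∑ i, momentError m γ₀ α₀ b (γhat (fold i)) (ρhat (fold i))
          (leaveOut fold (fold i) s) (s i)) := by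
    rw [thetaHat, sum_fold fold fun ℓ i =>
      psi m 0 (γhat ℓ (leaveOut fold ℓ s)) (linComb b (ρhat ℓ (leaveOut fold ℓ s))) (s i)]
    simp only [psi_eq_add_momentError (γ₀ := γ₀) (α₀ := α₀) 0 θ₀]
    rw [Finset.sum_sub_distrib, Finset.sum_add_distrib]
    simp only [Finset.sum_const, Finset.card_univ, Fintype.card_fin, nsmul_eq_mul]
    field_simp
    ring
  have h2 : ∀ ℓ, √(n : ℝ) * ((n : ℝ)⁻¹ * ∑ i : {i : Fin n // fold i = ℓ},
        (momentError m γ₀ α₀ b (γhat ℓ) (ρhat ℓ) (leaveOut fold ℓ s) (s i) - I ℓ))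
          + ((Finset.univ.filter fun i : Fin n => fold i = ℓ).card : ℝ) / n * (√(n : ℝ) * I ℓ)
      = (√(n : ℝ))⁻¹ * ∑ i : {i : Fin n // fold i = ℓ},
        momentError m γ₀ α₀ b (γhat ℓ) (ρhat ℓ) (leaveOut fold ℓ s) (s i) := fun ℓ => by
    rw [Finset.sum_sub_distrib, ← hs]
    simp only [Finset.sum_const, Finset.card_univ, Fintype.card_subtype, nsmul_eq_mul]
    ring
  simp only [h2]
  rw [← Finset.mul_sum, sum_fold_subtype fold fun ℓ i =>
    momentError m γ₀ α₀ b (γhat ℓ) (ρhat ℓ) (leaveOut fold ℓ s) (s i), h1, ← mul_assoc, hs, mul_add]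

/-- The variance estimator deviates from the oracle mean of squares by a Cauchy-Schwarz bound in
the mean square of the total error of the moment function. -/
lemma abs_varHat_sub_le (θ₀ : ℝ) (s : Fin n → Obs 𝒳 𝒵) {A G : ℝ}
    (hA : A = (n : ℝ)⁻¹ * ∑ i, psi m θ₀ γ₀ α₀ (s i) ^ 2)
    (hG : G = 2 * ∑ ℓ, ((n : ℝ)⁻¹ * ∑ i : {i : Fin n // fold i = ℓ},
        momentError m γ₀ α₀ b (γhat ℓ) (ρhat ℓ) (leaveOut fold ℓ s) (s i) ^ 2)
      + 2 * (thetaHat m b fold γhat ρhat s - θ₀) ^ 2) :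
    |varHat m b fold γhat ρhat s - A| ≤ 2 * √(A * G) + G := by
  set D := thetaHat m b fold γhat ρhat s - θ₀ with hD
  set a : Fin n → ℝ := fun i => psi m θ₀ γ₀ α₀ (s i) with ha
  set e : Fin n → ℝ := fun i => momentError m γ₀ α₀ b (γhat (fold i)) (ρhat (fold i))
    (leaveOut fold (fold i) s) (s i) with he
  set g : Fin n → ℝ := fun i => e i - D with hg
  have hn0 : (0 : ℝ) ≤ (n : ℝ)⁻¹ := by positivity
  have hV : varHat m b fold γhat ρhat s = (n : ℝ)⁻¹ * ∑ i, (a i + g i) ^ 2 := by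
    rw [varHat, sum_fold fold fun ℓ i => psi m (thetaHat m b fold γhat ρhat s)
      (γhat ℓ (leaveOut fold ℓ s)) (linComb b (ρhat ℓ (leaveOut fold ℓ s))) (s i) ^ 2]
    simp only [psi_eq_add_momentError (γ₀ := γ₀) (α₀ := α₀) (thetaHat m b fold γhat ρhat s) θ₀]
    simp only [ha, hg, he, hD, add_sub_assoc]
  have hE : ∑ ℓ, ((n : ℝ)⁻¹ * ∑ i : {i : Fin n // fold i = ℓ},
      momentError m γ₀ α₀ b (γhat ℓ) (ρhat ℓ) (leaveOut fold ℓ s) (s i) ^ 2)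
      = (n : ℝ)⁻¹ * ∑ i, e i ^ 2 := by
    rw [← Finset.mul_sum, sum_fold_subtype fold fun ℓ i =>
      momentError m γ₀ α₀ b (γhat ℓ) (ρhat ℓ) (leaveOut fold ℓ s) (s i) ^ 2]
  have hA' : A = (n : ℝ)⁻¹ * ∑ i, a i ^ 2 := hA
  have hA0 : 0 ≤ A := by rw [hA']; exact mul_nonneg hn0 (Finset.sum_nonneg fun _ _ => sq_nonneg _)
  have hgG : (n : ℝ)⁻¹ * ∑ i, g i ^ 2 ≤ G := by
    have h1 : ∑ i, g i ^ 2 ≤ ∑ i, (2 * e i ^ 2 + 2 * D ^ 2) := by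
      refine Finset.sum_le_sum fun i _ => ?_
      simp only [hg]
      nlinarith [sq_nonneg (e i + D)]
    have h2 : ∑ i, (2 * e i ^ 2 + 2 * D ^ 2) = 2 * ∑ i, e i ^ 2 + n * (2 * D ^ 2) := by
      rw [Finset.sum_add_distrib, ← Finset.mul_sum]; simp
    have h3 : (n : ℝ)⁻¹ * n ≤ 1 := inv_mul_le_one
    have h4 : (n : ℝ)⁻¹ * n * (2 * D ^ 2) ≤ 1 * (2 * D ^ 2) := by gcongr
    have h5 := mul_le_mul_of_nonneg_left (h1.trans_eq h2) hn0
    rw [hG, hE]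
    nlinarith
  have hcross : |(n : ℝ)⁻¹ * ∑ i, a i * g i| ≤ √(A * G) := by
    refine Real.abs_le_sqrt ?_
    calc ((n : ℝ)⁻¹ * ∑ i, a i * g i) ^ 2 = ((n : ℝ)⁻¹) ^ 2 * (∑ i, a i * g i) ^ 2 := mul_pow _ _ _
      _ ≤ ((n : ℝ)⁻¹) ^ 2 * ((∑ i, a i ^ 2) * ∑ i, g i ^ 2) := by
        gcongr
        exact Finset.sum_mul_sq_le_sq_mul_sq _ _ _
      _ = A * ((n : ℝ)⁻¹ * ∑ i, g i ^ 2) := by rw [hA']; ring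
      _ ≤ A * G := by gcongr
  have hsplit : varHat m b fold γhat ρhat s - A
      = 2 * ((n : ℝ)⁻¹ * ∑ i, a i * g i) + (n : ℝ)⁻¹ * ∑ i, g i ^ 2 := by
    rw [hV, hA']
    have : ∑ i, (a i + g i) ^ 2 = ∑ i, a i ^ 2 + 2 * ∑ i, a i * g i + ∑ i, g i ^ 2 := by
      rw [Finset.mul_sum, ← Finset.sum_add_distrib, ← Finset.sum_add_distrib]
      exact Finset.sum_congr rfl fun i _ => by ring
    rw [this]; ring
  have hg0 : 0 ≤ (n : ℝ)⁻¹ * ∑ i, g i ^ 2 :=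
    mul_nonneg hn0 (Finset.sum_nonneg fun _ _ => sq_nonneg _)
  rw [hsplit]
  refine (abs_add_le _ _).trans ?_
  rw [abs_mul, abs_two, abs_of_nonneg hg0]
  linarith

variable [MeasurableSpace 𝒳] [MeasurableSpace 𝒵]

lemma measurable_leaveOut (ℓ : Fin L) :
    Measurable (leaveOut fold ℓ : (Fin n → Obs 𝒳 𝒵) → Train 𝒳 𝒵 fold ℓ) :=
  measurable_pi_lambda _ fun i => measurable_pi_apply (i : Fin n)

lemma measurable_psi_estimated (hb : ∀ k, Measurable (b k)) {ℓ : Fin L}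
    {γh : Train 𝒳 𝒵 fold ℓ → Γ} {ρh : Train 𝒳 𝒵 fold ℓ → Fin p → ℝ}
    (hγ : Measurable fun t : Train 𝒳 𝒵 fold ℓ × 𝒳 => (γh t.1 : 𝒳 → ℝ) t.2)
    (hmγ : Measurable fun t : Train 𝒳 𝒵 fold ℓ × Obs 𝒳 𝒵 => m t.2 (γh t.1))
    (hρ : Measurable ρh) :
    Measurable fun t : Train 𝒳 𝒵 fold ℓ × Obs 𝒳 𝒵 =>
      psi m 0 (γh t.1) (linComb b (ρh t.1)) t.2 := by
  simp only [psi, linComb]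
  refine (hmγ.sub_const 0).add (Measurable.mul ?_ ?_)
  · refine Finset.measurable_sum _ fun k _ => Measurable.mul ?_ ?_
    · exact (hb k).comp (measurable_obs_z.comp measurable_snd)
    · exact (measurable_pi_apply k).comp (hρ.comp measurable_fst)
  · exact (measurable_fst.comp measurable_snd).sub
      (hγ.comp (measurable_fst.prodMk (measurable_obs_x.comp measurable_snd)))

lemma measurable_psi {γ : Γ} (hγ : Measurable (γ : 𝒳 → ℝ)) (hm : Measurable fun w => m w γ)
    {α : 𝒵 → ℝ} (hα : Measurable α) (θ : ℝ) : Measurable (psi m θ γ α) :=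
  (hm.sub_const θ).add ((hα.comp measurable_obs_z).mul
    (measurable_fst.sub (hγ.comp measurable_obs_x)))

lemma measurable_thetaHat (hb : ∀ k, Measurable (b k))
    (hγ : ∀ ℓ, Measurable fun t : Train 𝒳 𝒵 fold ℓ × 𝒳 => (γhat ℓ t.1 : 𝒳 → ℝ) t.2)
    (hmγ : ∀ ℓ, Measurable fun t : Train 𝒳 𝒵 fold ℓ × Obs 𝒳 𝒵 => m t.2 (γhat ℓ t.1))
    (hρ : ∀ ℓ, Measurable (ρhat ℓ)) : Measurable (thetaHat m b fold γhat ρhat) := by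
  refine Measurable.const_mul (Finset.measurable_sum _ fun ℓ _ =>
    Finset.measurable_sum _ fun i _ => ?_) _
  exact (measurable_psi_estimated hb (hγ ℓ) (hmγ ℓ) (hρ ℓ)).comp
    ((measurable_leaveOut ℓ).prodMk (measurable_pi_apply i))

variable {Ω : Type*} [MeasurableSpace Ω] {P : Measure Ω}
  {W : ℕ → Ω → Obs 𝒳 𝒵}

/-- The training sample of a fold is independent of the observations in the fold. -/
lemma indepFun_leaveOut_fold (hW_meas : ∀ i, Measurable (W i)) (hW_indep : iIndepFun W P)
    (fold : Fin n → Fin L) (ℓ : Fin L) :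
    IndepFun (fun ω => leaveOut fold ℓ fun i => W i ω)
      (fun ω (i : {i : Fin n // fold i = ℓ}) => W i ω) P := by
  have hind : iIndepFun (fun i : Fin n => W i) P := hW_indep.precomp Fin.val_injective
  have hdisj : Disjoint (Finset.univ.filter fun i : Fin n => fold i ≠ ℓ)
      (Finset.univ.filter fun i : Fin n => fold i = ℓ) := by
    rw [Finset.disjoint_filter]
    exact fun i _ h h' => h h'
  have h := hind.indepFun_finset _ _ hdisj fun i => hW_meas i
  exact h.comp
    (φ := fun t (i : {i : Fin n // fold i ≠ ℓ}) => t ⟨i.1, by simpa using i.2⟩)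
    (ψ := fun t (i : {i : Fin n // fold i = ℓ}) => t ⟨i.1, by simpa using i.2⟩)
    (measurable_pi_lambda _ fun i => measurable_pi_apply _)
    (measurable_pi_lambda _ fun i => measurable_pi_apply _)

end decomposition

lemma eventually_le_card_train {L : ℕ} (hL : 2 ≤ L) {fold : (n : ℕ) → Fin n → Fin L} {ℓ : Fin L}
    (h_fold : Tendsto
      (fun n : ℕ => ((Finset.univ.filter fun i : Fin n => fold n i = ℓ).card : ℝ) / n)
      atTop (𝓝 (1 / (L : ℝ)))) :
    ∀ᶠ n : ℕ in atTop, (n : ℝ) / 4 ≤ Fintype.card {i : Fin n // fold n i ≠ ℓ} := by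
  have hL' : (2 : ℝ) ≤ L := by exact_mod_cast hL
  have hlt : 1 / (L : ℝ) < 3 / 4 := by
    rw [div_lt_div_iff₀ (by linarith) (by norm_num)]; linarith
  filter_upwards [h_fold.eventually (gt_mem_nhds hlt), eventually_gt_atTop 0] with n hn hn0
  have hn' : (0 : ℝ) < n := by exact_mod_cast hn0
  rw [div_lt_iff₀ hn'] at hn
  have h := Finset.card_filter_add_card_filter_not (s := (Finset.univ : Finset (Fin n)))
    (fun i => fold n i = ℓ)
  rw [Finset.card_univ, Fintype.card_fin] at h
  have h' : ((Finset.univ.filter fun i : Fin n => fold n i = ℓ).card : ℝ)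
      + ((Finset.univ.filter fun i : Fin n => ¬ fold n i = ℓ).card : ℝ) = n := by exact_mod_cast h
  rw [Fintype.card_subtype]
  simp only [ne_eq]
  linarith

/-! ### Limit theorems for the oracle averages -/

section oracle

variable {Ω : Type*} [MeasurableSpace Ω] {P : Measure Ω}
  {𝒲 : Type*} [MeasurableSpace 𝒲] {F : Measure 𝒲} {W : ℕ → Ω → 𝒲}

lemma identDistrib_comp_of_map_eq (hW_meas : ∀ i, Measurable (W i))
    (hW_law : ∀ i, P.map (W i) = F) {g : 𝒲 → ℝ} (hg : Measurable g) (i : ℕ) :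
    IdentDistrib (fun ω => g (W i ω)) (fun ω => g (W 0 ω)) P P :=
  (IdentDistrib.mk (hW_meas i).aemeasurable (hW_meas 0).aemeasurable
    ((hW_law i).trans (hW_law 0).symm)).comp hg

variable [IsProbabilityMeasure P]

lemma tendsto_whp_mean (hW_meas : ∀ i, Measurable (W i)) (hW_law : ∀ i, P.map (W i) = F)
    (hW_indep : iIndepFun W P) {g : 𝒲 → ℝ} (hg : Measurable g) (hint : Integrable g F) :
    Tendsto (fun x : ℕ × Ω => (x.1 : ℝ)⁻¹ * ∑ i : Fin x.1, g (W i x.2)) (whp P)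
      (𝓝 (∫ w, g w ∂F)) := by
  have hmp : MeasurePreserving (W 0) P F := ⟨hW_meas 0, hW_law 0⟩
  have h := strong_law_ae_real (fun i ω => g (W i ω)) (hmp.integrable_comp_of_integrable hint)
    (fun i j hij => (hW_indep.indepFun hij).comp hg hg)
    (identDistrib_comp_of_map_eq hW_meas hW_law hg)
  have he : ∫ ω, g (W 0 ω) ∂P = ∫ w, g w ∂F := by
    rw [← hW_law 0, integral_map (hW_meas 0).aemeasurable hg.aestronglyMeasurable]
  rw [he] at h
  rw [← tendstoInMeasure_iff_tendsto_whp
    (X := fun n ω => (n : ℝ)⁻¹ * ∑ i : Fin n, g (W i ω))]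
  refine tendstoInMeasure_of_tendsto_ae (fun n => ?_) ?_
  · have hm : Measurable fun ω => ∑ i : Fin n, g (W i ω) :=
      Finset.measurable_sum _ fun i _ => hg.comp (hW_meas i)
    exact (hm.const_mul _).aestronglyMeasurable
  · filter_upwards [h] with ω hω
    refine hω.congr fun n => ?_
    rw [Finset.sum_range, div_eq_inv_mul]

lemma tendstoInDistribution_inv_sqrt_mul_sum_of_integral_eq_zero (hW_meas : ∀ i, Measurable (W i))
    (hW_law : ∀ i, P.map (W i) = F) (hW_indep : iIndepFun W P) {g : 𝒲 → ℝ} (hg : Measurable g)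
    (hL2 : MemLp g 2 F) (h0 : ∫ w, g w ∂F = 0) :
    TendstoInDistribution (fun (n : ℕ) ω => (√(n : ℝ))⁻¹ * ∑ i : Fin n, g (W i ω)) atTop
      (id : ℝ → ℝ) (fun _ => P) (gaussianReal 0 (∫ w, g w ^ 2 ∂F).toNNReal) := by
  have hmp : MeasurePreserving (W 0) P F := ⟨hW_meas 0, hW_law 0⟩
  have he : ∫ ω, g (W 0 ω) ∂P = 0 := by
    rw [← h0, ← hW_law 0, integral_map (hW_meas 0).aemeasurable hg.aestronglyMeasurable]
  have hvar : Var[fun ω => g (W 0 ω); P] = ∫ w, g w ^ 2 ∂F := by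
    have hgW : AEMeasurable (fun ω => g (W 0 ω)) P := (hg.comp (hW_meas 0)).aemeasurable
    rw [variance_of_integral_eq_zero hgW he, ← hW_law 0,
      integral_map (hW_meas 0).aemeasurable (hg.pow_const 2).aestronglyMeasurable]
  have h := tendstoInDistribution_inv_sqrt_mul_sum_sub (P := P) (X := fun i ω => g (W i ω))
    (Y := (id : ℝ → ℝ)) (P' := gaussianReal 0 (Var[fun ω => g (W 0 ω); P]).toNNReal) HasLaw.id
    (hL2.comp_measurePreserving hmp) (hW_indep.comp (fun _ => g) fun _ => hg)
    (identDistrib_comp_of_map_eq hW_meas hW_law hg)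
  rw [hvar] at h
  simpa only [he, mul_zero, sub_zero, Finset.sum_range] using h

end oracle

end PGMM

theorem mainTheorem3
    -- probability space, data `W i = (Y i, X i, Z i)`, i.i.d. with law `F₀`
    {Ω 𝒳 𝒵 : Type*} [MeasurableSpace Ω] [MeasurableSpace 𝒳] [MeasurableSpace 𝒵]
    (P : Measure Ω) [IsProbabilityMeasure P]
    (F₀ : Measure (PGMM.Obs 𝒳 𝒵)) [IsProbabilityMeasure F₀]
    (W : ℕ → Ω → PGMM.Obs 𝒳 𝒵)
    (hW_meas : ∀ i, Measurable (W i))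
    (hW_law : ∀ i, P.map (W i) = F₀)
    (hW_indep : iIndepFun W P)
    -- linear space of square integrable functions, linear functional, structural function
    (Γ : Submodule ℝ (𝒳 → ℝ))
    (hΓ : ∀ γ ∈ Γ, Measurable γ ∧ MemLp (fun w : PGMM.Obs 𝒳 𝒵 => γ w.x) 2 F₀)
    (m : PGMM.Obs 𝒳 𝒵 → Γ →ₗ[ℝ] ℝ)
    (hm_meas : ∀ γ : Γ, Measurable fun w => m w γ)
    (γ₀ : Γ)
    (h_exog : F₀[fun w : PGMM.Obs 𝒳 𝒵 => w.y - (γ₀ : 𝒳 → ℝ) w.x | PGMM.sigmaZ 𝒳 𝒵] =ᵐ[F₀] 0)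
    -- Riesz representer
    (α₀ : 𝒵 → ℝ) (hα₀_meas : Measurable α₀)
    (h_riesz : ∀ γ : Γ, Integrable (fun w => m w γ) F₀ ∧
      ∫ w, m w γ ∂F₀ = ∫ w : PGMM.Obs 𝒳 𝒵, α₀ w.z * (γ : 𝒳 → ℝ) w.x ∂F₀)
    -- dictionaries `b` (dimension `p n`) and `d` (dimension `q n`)
    (p q : ℕ → ℕ) (hpq : ∀ n, p n ≤ q n) (hq : ∀ n, 2 ≤ q n)
    (b : (n : ℕ) → Fin (p n) → 𝒵 → ℝ) (hb_meas : ∀ n k, Measurable (b n k))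
    (d : (n : ℕ) → Fin (q n) → Γ)
    -- cross-fitting: `L` folds of about equal size, estimators built off the fold
    (L : ℕ) (hL : 2 ≤ L)
    (fold : (n : ℕ) → Fin n → Fin L)
    (h_fold : ∀ ℓ : Fin L, Tendsto
      (fun n : ℕ => ((Finset.univ.filter fun i : Fin n => fold n i = ℓ).card : ℝ) / n)
      atTop (𝓝 (1 / (L : ℝ))))
    (γhat : (n : ℕ) → (ℓ : Fin L) → PGMM.Train 𝒳 𝒵 (fold n) ℓ → Γ)
    (hγhat_meas : ∀ n ℓ, Measurable
      fun t : PGMM.Train 𝒳 𝒵 (fold n) ℓ × 𝒳 => (γhat n ℓ t.1 : 𝒳 → ℝ) t.2)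
    (hmγhat_meas : ∀ n ℓ, Measurable
      fun t : PGMM.Train 𝒳 𝒵 (fold n) ℓ × PGMM.Obs 𝒳 𝒵 => m t.2 (γhat n ℓ t.1))
    -- weight matrices, penalty, and the penalized GMM estimator of the Riesz representer
    (Omhat : (n : ℕ) → (ℓ : Fin L) → PGMM.Train 𝒳 𝒵 (fold n) ℓ →
      Matrix (Fin (q n)) (Fin (q n)) ℝ)
    (hOmhat : ∀ n ℓ t, (Omhat n ℓ t).PosSemidef)
    (lam : ℕ → ℝ) (hlam : ∀ n, 0 < lam n)
    (ρhat : (n : ℕ) → (ℓ : Fin L) → PGMM.Train 𝒳 𝒵 (fold n) ℓ → Fin (p n) → ℝ)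
    (hρhat_meas : ∀ n ℓ, Measurable (ρhat n ℓ))
    (hρhat : ∀ n ℓ t, IsMinOn
      (PGMM.pgmmObjective (PGMM.sampleM m (d n) t)
        (PGMM.sampleG (fun j => (d n j : 𝒳 → ℝ)) (b n) t) (Omhat n ℓ t) (lam n))
      Set.univ (ρhat n ℓ t))
    -- weight matrix condition
    (Om : (n : ℕ) → Matrix (Fin (q n)) (Fin (q n)) ℝ)
    (h_weight_rate : ∀ ℓ : Fin L, PGMM.IsBigOInProb P
      (fun n ω => ENNReal.ofReal (PGMM.rowSumNorm
        (Omhat n ℓ (PGMM.leaveOut (fold n) ℓ fun i => W i ω) - Om n)))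
      (PGMM.epsG q))
    (h_weight_bdd : ∃ C : ℝ, ∀ᶠ n in atTop, PGMM.rowSumNorm (Om n) ≤ C)
    -- bounded dictionaries
    (h_dict : ∃ Cb Cd : ℝ, ∀ᶠ n in atTop, ∀ᵐ w ∂F₀,
      (∀ k, |b n k w.z| ≤ Cb) ∧ ∀ j, |(d n j : 𝒳 → ℝ) w.x| ≤ Cd)
    -- rate for the sample moments `M̂`
    (εM : ℕ → ℝ)
    (h_M_rate : ∀ ℓ : Fin L, PGMM.IsBigOInProb P
      (fun n ω => ‖PGMM.sampleM m (d n) (PGMM.leaveOut (fold n) ℓ fun i => W i ω)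
        - PGMM.popM F₀ m (d n)‖ₑ) εM)
    (hεM : Tendsto εM atTop (𝓝 0))
    -- sparse approximation of the Riesz representer
    (sbar : ℕ → ℕ) (ρbar : (n : ℕ) → Fin (p n) → ℝ)
    (h_sparse : ∀ n, (Finset.univ.filter fun k => ρbar n k ≠ 0).card ≤ sbar n)
    (h_approx : ∃ C : ℝ, 1 < C ∧ ∀ᶠ n in atTop,
      PGMM.normZ F₀ (fun z => α₀ z - PGMM.linComb (b n) (ρbar n) z) ^ 2
        ≤ ENNReal.ofReal (C * sbar n * PGMM.epsMax q εM n ^ 2))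
    (h_ρbar_l1 : ∃ A : ℝ, ∀ᶠ n in atTop, ∑ k, |ρbar n k| ≤ A)
    -- eigenvalue conditions on `G' Ω_q G`
    (h_maxeig : ∃ C : ℝ, ∀ᶠ n in atTop, PGMM.EigenvaluesLE
      (PGMM.gramG (PGMM.popG F₀ (fun j => (d n j : 𝒳 → ℝ)) (b n)) (Om n)) C)
    (h_RE : ∃ c : ℝ, 0 < c ∧ ∀ᶠ n in atTop, PGMM.RestrictedEigenvalueGE
      (PGMM.gramG (PGMM.popG F₀ (fun j => (d n j : 𝒳 → ℝ)) (b n)) (Om n)) (sbar n) c)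
    -- bounded moment functionals of the dictionary
    (h_m_bdd : ∃ C : ℝ, Tendsto (fun n => F₀ {w | ∀ j, |m w (d n j)| ≤ C}) atTop (𝓝 1))
    -- bounded representer and conditional variance, finite second moment
    (hα₀_bdd : ∃ C : ℝ, ∀ᵐ w ∂F₀, |α₀ w.z| ≤ C)
    (h_err_sq : MemLp (fun w : PGMM.Obs 𝒳 𝒵 => w.y - (γ₀ : 𝒳 → ℝ) w.x) 2 F₀)
    (h_condvar : ∃ C : ℝ, F₀[fun w : PGMM.Obs 𝒳 𝒵 => (w.y - (γ₀ : 𝒳 → ℝ) w.x) ^ 2 |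
      PGMM.sigmaZ 𝒳 𝒵] ≤ᵐ[F₀] fun _ => C)
    (h_m_sq : MemLp (fun w => m w γ₀) 2 F₀)
    -- mean square consistency
    (h_m_consist : ∀ ℓ : Fin L, PGMM.TendstoZeroInProb P (fun n ω =>
      ∫⁻ w, ENNReal.ofReal
        ((m w (γhat n ℓ (PGMM.leaveOut (fold n) ℓ fun i => W i ω)) - m w γ₀) ^ 2) ∂F₀))
    (h_γ_consist : ∀ ℓ : Fin L, PGMM.TendstoZeroInProb P (fun n ω =>
      PGMM.normX F₀ (γhat n ℓ (PGMM.leaveOut (fold n) ℓ fun i => W i ω) - γ₀ : Γ)))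
    -- projected norm rate
    (κγ : ℕ → ℝ)
    (h_proj_rate : ∀ ℓ : Fin L, PGMM.IsBigOInProb P (fun n ω =>
      PGMM.projNorm F₀ (γhat n ℓ (PGMM.leaveOut (fold n) ℓ fun i => W i ω) - γ₀ : Γ)) κγ)
    (hκγ : Tendsto κγ atTop (𝓝 0))
    -- rate conditions, with `κ_n^α = s̄ λ_n`
    (h_lam : PGMM.epsMax q εM =o[atTop] lam)
    (h_slam : Tendsto (fun n => (sbar n : ℝ) * lam n) atTop (𝓝 0))
    (h_rates : Tendsto (fun n : ℕ => √(n : ℝ) * ((sbar n : ℝ) * lam n) * κγ n) atTop (𝓝 0))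
    -- the target and the asymptotic variance
    (θ₀ V : ℝ) (hθ₀ : θ₀ = ∫ w, m w γ₀ ∂F₀)
    (hV : V = ∫ w, PGMM.psi m θ₀ γ₀ α₀ w ^ 2 ∂F₀) :
    MemLp (PGMM.psi m θ₀ γ₀ α₀) 2 F₀ ∧
    TendstoInDistribution
      (fun (n : ℕ) (ω : Ω) => √(n : ℝ) *
        (PGMM.thetaHat m (b n) (fold n) (γhat n) (ρhat n) (fun i => W i ω) - θ₀))
      atTop (id : ℝ → ℝ) (fun _ => P) (gaussianReal 0 V.toNNReal) ∧
    TendstoInMeasure P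
      (fun (n : ℕ) (ω : Ω) =>
        PGMM.varHat m (b n) (fold n) (γhat n) (ρhat n) (fun i => W i ω))
      atTop (fun _ => V) := by
  obtain ⟨R₀, hα₀R⟩ := hα₀_bdd
  obtain ⟨Cv, hCv⟩ := h_condvar
  obtain ⟨COm, hCOm⟩ := h_weight_bdd
  obtain ⟨Cb, Cd, hdict⟩ := h_dict
  obtain ⟨Ca, -, happ⟩ := h_approx
  obtain ⟨A, hA⟩ := h_ρbar_l1
  obtain ⟨c, hc, hRE⟩ := h_RE
  have hψL2 : MemLp (PGMM.psi m θ₀ γ₀ α₀) 2 F₀ :=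
    PGMM.memLp_psi h_err_sq h_m_sq hα₀_meas hα₀R θ₀
  have hψm : Measurable (PGMM.psi m θ₀ γ₀ α₀) :=
    PGMM.measurable_psi (hΓ _ γ₀.2).1 (hm_meas γ₀) hα₀_meas θ₀
  have hψ0 : ∫ w, PGMM.psi m θ₀ γ₀ α₀ w ∂F₀ = 0 := by
    rw [PGMM.integral_psi h_exog h_err_sq (h_riesz γ₀).1 hα₀_meas hα₀R, hθ₀, sub_self]
  have hbd : ∀ᶠ n in atTop, ∀ᵐ w : PGMM.Obs 𝒳 𝒵 ∂F₀, ∀ k, |b n k w.z| ≤ Cb :=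
    hdict.mono fun n hn => hn.mono fun w hw => hw.1
  have hslam0 : ∀ n, 0 ≤ (sbar n : ℝ) * lam n := fun n =>
    mul_nonneg (Nat.cast_nonneg _) (hlam n).le
  -- the training sample of fold `ℓ`
  let T : (n : ℕ) → (ℓ : Fin L) → Ω → PGMM.Train 𝒳 𝒵 (fold n) ℓ :=
    fun n ℓ ω => PGMM.leaveOut (fold n) ℓ fun i => W i ω
  have hTm : ∀ n ℓ, Measurable (T n ℓ) := fun n ℓ =>
    (PGMM.measurable_leaveOut ℓ).comp (measurable_pi_lambda _ fun i => hW_meas i)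
  -- the error of the estimated moment function, its mean square and its conditional mean
  let f : (n : ℕ) → (ℓ : Fin L) → PGMM.Train 𝒳 𝒵 (fold n) ℓ → PGMM.Obs 𝒳 𝒵 → ℝ := fun n ℓ =>
    PGMM.momentError m γ₀ α₀ (b n) (γhat n ℓ) (ρhat n ℓ)
  have hfm : ∀ n ℓ, Measurable (Function.uncurry (f n ℓ)) := fun n ℓ =>
    (PGMM.measurable_psi_estimated (hb_meas n) (hγhat_meas n ℓ) (hmγhat_meas n ℓ)
      (hρhat_meas n ℓ)).sub
      ((PGMM.measurable_psi (hΓ _ γ₀.2).1 (hm_meas γ₀) hα₀_meas 0).comp measurable_snd)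
  have hrate : ∀ ℓ, ∃ K R : ℝ, 0 ≤ K ∧ 0 ≤ R ∧ ∀ᶠ x in PGMM.whp P,
      PGMM.normZ F₀ (fun z => α₀ z - PGMM.linComb (b x.1) (ρhat x.1 ℓ (T x.1 ℓ x.2)) z)
        ≤ ENNReal.ofReal (K * (sbar x.1 * lam x.1)) ∧
      ∑ k, |ρhat x.1 ℓ (T x.1 ℓ x.2) k| ≤ R := fun ℓ =>
    PGMM.exists_eventually_whp_normZ_sub_le hΓ hα₀_meas hα₀R h_riesz hpq hq hb_meas
      (U := fun n (i : {i : Fin n // fold n i ≠ ℓ}) => W i)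
      (fun n i => hW_meas _) (fun n i => hW_law _)
      (fun n => hW_indep.precomp (Fin.val_injective.comp Subtype.val_injective))
      (PGMM.eventually_le_card_train hL (h_fold ℓ))
      (Omh := fun n ω => Omhat n ℓ (T n ℓ ω)) (fun n ω => hOmhat n ℓ _) hlam
      (ρh := fun n ω => ρhat n ℓ (T n ℓ ω)) (fun n ω => hρhat n ℓ _)
      (h_weight_rate ℓ) hCOm hdict (h_M_rate ℓ) hεM h_sparse happ hA hc hRE h_lam h_slam
  have hmse : ∀ ℓ, Tendsto (fun x : ℕ × Ω =>
      ∫⁻ w, ENNReal.ofReal (f x.1 ℓ (T x.1 ℓ x.2) w ^ 2) ∂F₀) (PGMM.whp P) (𝓝 0) := fun ℓ => by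
    obtain ⟨K, R, -, -, hKR⟩ := hrate ℓ
    exact PGMM.tendsto_whp_lintegral_psi_sub_sq (γh := fun n ω => γhat n ℓ (T n ℓ ω))
      (ρh := fun n ω => ρhat n ℓ (T n ℓ ω))
      (r := fun n => sbar n * lam n) hΓ hm_meas h_err_sq hCv hα₀_meas
      hα₀R hb_meas hbd hKR h_slam (h_m_consist ℓ) (h_γ_consist ℓ)
  have hbias : ∀ ℓ, Tendsto (fun x : ℕ × Ω =>
      √(x.1 : ℝ) * ∫ w, f x.1 ℓ (T x.1 ℓ x.2) w ∂F₀) (PGMM.whp P) (𝓝 0) := fun ℓ => by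
    obtain ⟨K, R, hK, -, hKR⟩ := hrate ℓ
    exact PGMM.tendsto_whp_sqrt_mul_integral_psi_sub (γh := fun n ω => γhat n ℓ (T n ℓ ω))
      (ρh := fun n ω => ρhat n ℓ (T n ℓ ω))
      (r := fun n => sbar n * lam n) hΓ h_exog h_err_sq h_riesz hα₀_meas
      hα₀R hb_meas hbd hK hKR hslam0 (h_proj_rate ℓ) h_rates
  have hcard : ∀ ℓ n, Fintype.card {i : Fin n // fold n i = ℓ} ≤ n := fun ℓ n =>
    (Fintype.card_subtype_le _).trans (Fintype.card_fin n).le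
  have hTU : ∀ ℓ n, IndepFun (T n ℓ) (fun ω (i : {i : Fin n // fold n i = ℓ}) => W i ω) P :=
    fun ℓ n => PGMM.indepFun_leaveOut_fold hW_meas hW_indep (fold n) ℓ
  have hsum : ∀ ℓ, Tendsto (fun x : ℕ × Ω => √(x.1 : ℝ) * ((x.1 : ℝ)⁻¹ *
      ∑ i : {i : Fin x.1 // fold x.1 i = ℓ},
        (f x.1 ℓ (T x.1 ℓ x.2) (W i x.2) - ∫ w, f x.1 ℓ (T x.1 ℓ x.2) w ∂F₀)))
      (PGMM.whp P) (𝓝 0) := fun ℓ =>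
    PGMM.tendsto_whp_sqrt_mul_fold_sum (T := fun n => T n ℓ)
      (U := fun n (i : {i : Fin n // fold n i = ℓ}) => W i) (f := fun n => f n ℓ)
      (fun n => hTm n ℓ) (fun n i => hW_meas _) (fun n i => hW_law _)
      (fun n => hW_indep.precomp (Fin.val_injective.comp Subtype.val_injective))
      (hTU ℓ) (hcard ℓ) (fun n => hfm n ℓ) (hmse ℓ)
  have hsq : ∀ ℓ, Tendsto (fun x : ℕ × Ω => (x.1 : ℝ)⁻¹ *
      ∑ i : {i : Fin x.1 // fold x.1 i = ℓ}, f x.1 ℓ (T x.1 ℓ x.2) (W i x.2) ^ 2)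
      (PGMM.whp P) (𝓝 0) := fun ℓ =>
    PGMM.tendsto_whp_fold_mean_sq (T := fun n => T n ℓ)
      (U := fun n (i : {i : Fin n // fold n i = ℓ}) => W i) (f := fun n => f n ℓ)
      (fun n => hTm n ℓ) (fun n i => hW_meas _) (fun n i => hW_law _)
      (hTU ℓ) (hcard ℓ) (fun n => hfm n ℓ) (hmse ℓ)
  -- the estimator is asymptotically equivalent to the oracle average
  have hrem : Tendsto (fun x : ℕ × Ω => √(x.1 : ℝ) *
      (PGMM.thetaHat m (b x.1) (fold x.1) (γhat x.1) (ρhat x.1) (fun i => W i x.2) - θ₀)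
        - (√(x.1 : ℝ))⁻¹ * ∑ i : Fin x.1, PGMM.psi m θ₀ γ₀ α₀ (W i x.2))
      (PGMM.whp P) (𝓝 0) := by
    have hlim := tendsto_finsetSum (Finset.univ : Finset (Fin L)) fun ℓ _ =>
      (hsum ℓ).add (((h_fold ℓ).comp (PGMM.tendsto_fst_whp (P := P))).mul (hbias ℓ))
    simp only [mul_zero, add_zero, Finset.sum_const_zero] at hlim
    refine hlim.congr' ?_
    filter_upwards [PGMM.eventually_whp_of_eventually (eventually_gt_atTop 0)] with x hx
    rw [PGMM.sqrt_mul_thetaHat_sub (γ₀ := γ₀) (α₀ := α₀) hx θ₀ (fun i => W i x.2)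
      fun ℓ => ∫ w, f x.1 ℓ (T x.1 ℓ x.2) w ∂F₀, add_sub_cancel_left]
    rfl
  have hWfin : ∀ n : ℕ, Measurable fun ω (i : Fin n) => W i ω := fun n =>
    measurable_pi_lambda _ fun i => hW_meas i
  refine ⟨hψL2, ?_, ?_⟩
  · have hclt := PGMM.tendstoInDistribution_inv_sqrt_mul_sum_of_integral_eq_zero hW_meas hW_law
      hW_indep hψm hψL2 hψ0
    rw [← hV] at hclt
    refine tendstoInDistribution_of_tendstoInMeasure_sub _ _ hclt ?_ fun n => ?_
    · exact PGMM.tendstoInMeasure_iff_tendsto_whp.2 hrem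
    · exact ((((PGMM.measurable_thetaHat (hb_meas n) (hγhat_meas n) (hmγhat_meas n)
        (hρhat_meas n)).comp (hWfin n)).sub_const θ₀).const_mul _).aemeasurable
  · -- consistency of the estimator, from the equivalence with the oracle average
    have hinv : Tendsto (fun x : ℕ × Ω => (√(x.1 : ℝ))⁻¹) (PGMM.whp P) (𝓝 0) :=
      (tendsto_inv_atTop_zero.comp (Real.tendsto_sqrt_atTop.comp
        tendsto_natCast_atTop_atTop)).comp PGMM.tendsto_fst_whp
    have hθ : Tendsto (fun x : ℕ × Ω =>
        PGMM.thetaHat m (b x.1) (fold x.1) (γhat x.1) (ρhat x.1) (fun i => W i x.2) - θ₀)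
        (PGMM.whp P) (𝓝 0) := by
      have h1 := (PGMM.tendsto_whp_mean hW_meas hW_law hW_indep hψm
        (hψL2.integrable one_le_two)).add (hinv.mul hrem)
      rw [hψ0, mul_zero, add_zero] at h1
      refine h1.congr' ?_
      filter_upwards [PGMM.eventually_whp_of_eventually (eventually_gt_atTop 0)] with x hx
      have hx' : (0 : ℝ) < x.1 := by exact_mod_cast hx
      have hs : √(x.1 : ℝ) ≠ 0 := (Real.sqrt_pos.2 hx').ne'
      rw [mul_sub, ← mul_assoc, ← mul_assoc, inv_mul_cancel₀ hs, one_mul, ← mul_inv,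
        Real.mul_self_sqrt hx'.le]
      ring
    have hA' := PGMM.tendsto_whp_mean hW_meas hW_law hW_indep (hψm.pow_const 2)
      hψL2.integrable_sq
    rw [← hV] at hA'
    have hG := ((tendsto_finsetSum (Finset.univ : Finset (Fin L)) fun ℓ _ => hsq ℓ).const_mul
      2).add ((hθ.pow 2).const_mul 2)
    simp only [Finset.sum_const_zero, mul_zero, ne_eq, OfNat.ofNat_ne_zero, not_false_eq_true,
      zero_pow, add_zero] at hG
    have hbound := (((hA'.mul hG).sqrt).const_mul 2).add hG
    simp only [mul_zero, Real.sqrt_zero, add_zero] at hbound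
    have hdiff : Tendsto (fun x : ℕ × Ω =>
        PGMM.varHat m (b x.1) (fold x.1) (γhat x.1) (ρhat x.1) (fun i => W i x.2)
          - (x.1 : ℝ)⁻¹ * ∑ i : Fin x.1, PGMM.psi m θ₀ γ₀ α₀ (W i x.2) ^ 2)
        (PGMM.whp P) (𝓝 0) := squeeze_zero_norm (fun x : ℕ × Ω =>
      PGMM.abs_varHat_sub_le (m := m) (γ₀ := γ₀) (α₀ := α₀) (b := b x.1) (fold := fold x.1)
        (γhat := γhat x.1) (ρhat := ρhat x.1) θ₀ (fun i => W i x.2) rfl rfl) hbound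
    have hfin := hdiff.add hA'
    rw [zero_add] at hfin
    refine PGMM.tendstoInMeasure_iff_tendsto_whp.2 (hfin.congr fun x => ?_)
    exact sub_add_cancel _ _
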